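/- **Setting.** Let $\mathscr D$ be the dyadic intervals $[2^{-j}k,2^{-j}(k+1))$, $j,k\in\mathbb Z$, of $\mathbb R$; let $h_{[0,1)}=1_{[0,1/2)}-1_{[1/2,1)}$ and $h_I(t)=h_{[0,1)}\big((t-\inf I)/|I|\big)$ for $I\in\mathscr D$. For $m\in\mathbb Z$ put $\tau_m(I)=I+m|I|$. For a Banach space $X$ and $1<p<\infty$ let $L^p_X=L^p(\mathbb R;X)$ (Lebesgue measure), $\langle u,h_I\rangle=\int u\,h_I\,dt\in X$, and let $U_m$ be the linear extension of $h_I\mapsto 1_{\tau_m(I)}-1_I$, that is $$U_m v=\sum_{I\in\mathscr D}\langle v,h_I\rangle\,(1_{\tau_m(I)}-1_I)\,|I|^{-1}.$$ For $\mathscr B\subset\mathscr D$ let $P_{\mathscr B}u=\sum_{I\in\mathscr B}\langle u,h_I\rangle\,h_I\,|I|^{-1}$. Let $\mathscr U_p(X)\in[0,\infty]$ be the UMD constant, the least $\beta$ such that $\big\|\sum_{j<n}\varepsilon_jd_j\big\|_{L^p(\mu;X)}\le\beta\,\big\|\sum_{j<n}d_j\big\|_{L^p(\mu;X)}$ for all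 $n$, all $X$-valued $L^p$ martingale difference sequences $(d_j)_{j\ge 0}$ on probability spaces, and all signs $\varepsilon_j\in\{-1,1\}$. **Splitting of $\mathscr D$.** Let $m\ge1$ be an integer. If $m\ge2$ let $\lambda$ be the integer with $2^{\lambda-3}\le m<2^{\lambda-2}$; if $m=1$ let $\lambda=4$. Put $L(m)=\lambda-1$ and $K(m)=2L(m)+1$. For $0\le i\le L(m)$ let * $\mathscr A_i=\{I\in\mathscr D:\ |I|=2^{-(\lambda j+i)}\text{ for some }j\in\mathbb Z\}$; * $\mathscr A_i^{(0)}$ be the set of $J\in\mathscr A_i$ for which there is $I\in\mathscr A_i$ with $|J|=2^{-\lambda}|I|$, $J\subset I$ and $\tau_m(J)\subset I$; and $\mathscr A_i^{(1)}=\mathscr A_i\setminus\mathscr A_i^{(0)}$. Let $\mathscr E=\{\tau_k(I):I\in\mathscr D,\ \inf I=0,\ 0\le k\le m-1\}$, $\mathscr D_{\rm even}=\bigcup_{j\text{ even}}\tau_{jm}(\mathscr E)$, $\mathscr D_{\rm odd}=\bigcup_{j\text{ odd}}\tau_{jm}(\mathscr E)$. For $\delta\in\{0,1\}$ and $0\le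 i\le L(m)$ put $\mathscr B_i^{(\delta)}=\mathscr A_i^{(\delta)}\cap\mathscr D_{\rm even}$ and $\mathscr B_{i+L(m)+1}^{(\delta)}=\mathscr A_i^{(\delta)}\cap\mathscr D_{\rm odd}$. For $0\le i\le K(m)$ let $\mathscr B_i^{(1,0)}$ (respectively $\mathscr B_i^{(1,1)}$) be the set of $I\in\mathscr B_i^{(1)}$ with $\inf\tau_m(I)\ne\inf\operatorname{pred}^\lambda(\tau_m(I))$ (respectively $=$), where $\operatorname{pred}(J)$ is the dyadic interval of length $2|J|$ containing $J$. Write $P_i^{(0)}=P_{\mathscr B_i^{(0)}}$ and $P_i^{(1,\varepsilon)}=P_{\mathscr B_i^{(1,\varepsilon)}}$, $\varepsilon\in\{0,1\}$. **Theorem.** For every integer $m\ge1$ we have $K(m)\le 7+2\log_2 m$. Let $1<p<\infty$, let $X$ be a Banach space with the UMD property, i.e. $\mathscr U_p(X)<\infty$, and let $m\ge1$, $0\le i\le K(m)$, $\varepsilon\in\{0,1\}$. Then for all $u\in L^p_X$ the series defining $P_i^{(0)}u$, $P_i^{(1,\varepsilon)}u$, $U_mP_i^{(0)}u$ and $U_mP_i^{(1,\varepsilon)}u$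 converge unconditionally in $L^p_X$, and $$\|U_mP_i^{(0)}u\|_{L^p_X}\le C\,\|P_i^{(0)}u\|_{L^p_X},\qquad \|U_mP_i^{(1,\varepsilon)}u\|_{L^p_X}\le C\,\|P_i^{(1,\varepsilon)}u\|_{L^p_X},$$ where the constant $C$ depends only on $\mathscr U_p(X)$. -/

import Mathlib

open MeasureTheory Set
open scoped ENNReal NNReal

noncomputable section

/-! ### Martingale difference sequences and the UMD constant -/

/-- `d 0, d 1, …` is a martingale difference sequence in `L^p` with respect to `ℱ`:
each `d n` is `ℱ n`-measurable, lies in `L^p`, and `𝔼[d (n + 1) | ℱ n] = 0`. -/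
structure IsMartingaleDiffSeq {Ω X : Type*} [NormedAddCommGroup X] [NormedSpace ℝ X]
    [CompleteSpace X] {m0 : MeasurableSpace Ω} (p : ℝ≥0∞) (d : ℕ → Ω → X)
    (ℱ : Filtration ℕ m0) (μ : Measure Ω) : Prop where
  adapted : ∀ n, StronglyMeasurable[ℱ n] (d n)
  memLp : ∀ n, MemLp (d n) p μ
  condExp_eq_zero : ∀ n, μ[d (n + 1) | ℱ n] =ᵐ[μ] 0

/-- `β` bounds all `±1`-transforms of `X`-valued martingale difference sequences in `L^p`. -/
def IsUMDBound (p : ℝ≥0∞) (X : Type*) [NormedAddCommGroup X] [NormedSpace ℝ X]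
    [CompleteSpace X] (β : ℝ≥0∞) : Prop :=
  ∀ (Ω : Type) (m0 : MeasurableSpace Ω) (μ : Measure Ω) (_ : IsProbabilityMeasure μ)
    (ℱ : Filtration ℕ m0) (d : ℕ → Ω → X), IsMartingaleDiffSeq p d ℱ μ →
    ∀ ε : ℕ → ℝ, (∀ j, ε j = 1 ∨ ε j = -1) → ∀ n : ℕ,
      eLpNorm (fun ω => ∑ j ∈ Finset.range n, ε j • d j ω) p μ
        ≤ β * eLpNorm (fun ω => ∑ j ∈ Finset.range n, d j ω) p μ

/-- The UMD constant `𝒰_p(X) ∈ [0, ∞]`, the least bound. It is finite when `X` is a UMD space. -/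
def umdConst (p : ℝ≥0∞) (X : Type*) [NormedAddCommGroup X] [NormedSpace ℝ X]
    [CompleteSpace X] : ℝ≥0∞ :=
  sInf {β | IsUMDBound p X β}

/-! ### Dyadic intervals -/

/-- The dyadic interval `[2^{-j} k, 2^{-j} (k+1))`, recorded by its scale `j` and position `k`. -/
@[ext]
structure DyadicInterval where
  scale : ℤ
  pos : ℤ

namespace DyadicInterval

/-- `|I|` -/
def length (I : DyadicInterval) : ℝ := (2 : ℝ) ^ (-I.scale)

/-- `inf I` -/
def left (I : DyadicInterval) : ℝ := (2 : ℝ) ^ (-I.scale) * I.pos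

/-- The interval as a subset of the real line. -/
def toSet (I : DyadicInterval) : Set ℝ :=
  Ico ((2 : ℝ) ^ (-I.scale) * I.pos) ((2 : ℝ) ^ (-I.scale) * (I.pos + 1))

/-- `τ_m(I) = I + m |I|` -/
def shift (m : ℤ) (I : DyadicInterval) : DyadicInterval := ⟨I.scale, I.pos + m⟩

/-- The dyadic predecessor: the dyadic interval of twice the length that contains `I`. -/
def pred (I : DyadicInterval) : DyadicInterval := ⟨I.scale - 1, I.pos / 2⟩

theorem length_pos (I : DyadicInterval) : 0 < I.length := by
  unfold length; positivity

theorem length_pred (I : DyadicInterval) : I.pred.length = 2 * I.length := by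
  simp only [length, pred]
  rw [show -(I.scale - 1) = -I.scale + 1 by ring, zpow_add₀ (by norm_num)]
  ring

theorem toSet_subset_pred (I : DyadicInterval) : I.toSet ⊆ I.pred.toSet := by
  have h0 : (0 : ℝ) < (2 : ℝ) ^ (-I.scale) := by positivity
  have h1 : (2 : ℝ) ^ (-(I.scale - 1)) = 2 * (2 : ℝ) ^ (-I.scale) := by
    rw [show -(I.scale - 1) = -I.scale + 1 by ring, zpow_add₀ (by norm_num)]
    ring
  have h2 : (2 : ℝ) * ((I.pos / 2 : ℤ) : ℝ) ≤ (I.pos : ℝ) := by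
    exact_mod_cast (by omega : 2 * (I.pos / 2) ≤ I.pos)
  have h3 : (I.pos : ℝ) + 1 ≤ 2 * (((I.pos / 2 : ℤ) : ℝ) + 1) := by
    exact_mod_cast (by omega : I.pos + 1 ≤ 2 * (I.pos / 2 + 1))
  simp only [toSet, pred, h1]
  apply Ico_subset_Ico <;> nlinarith

theorem toSet_shift (m : ℤ) (I : DyadicInterval) :
    (I.shift m).toSet = (fun t => t + m * I.length) '' I.toSet := by
  simp only [toSet, shift, length, image_add_const_Ico]
  congr 1 <;> push_cast <;> ring

theorem measurableSet_toSet (I : DyadicInterval) : MeasurableSet I.toSet := measurableSet_Ico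

theorem volume_toSet (I : DyadicInterval) : volume I.toSet = ENNReal.ofReal I.length := by
  simp only [toSet, length, Real.volume_Ico]
  congr 1; ring

/-! ### The Haar system -/

/-- `h_{[0,1)} = 1_{[0,1/2)} - 1_{[1/2,1)}` -/
def haarUnit (t : ℝ) : ℝ :=
  (Ico (0 : ℝ) (1 / 2)).indicator 1 t - (Ico (1 / 2 : ℝ) 1).indicator 1 t

/-- `h_I(t) = h_{[0,1)}((t - inf I) / |I|)` -/
def haar (I : DyadicInterval) (t : ℝ) : ℝ := haarUnit ((t - I.left) / I.length)

/-- `1_{τ_m(I)} - 1_I`, the image of `h_I` under `U_m`. -/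
def rearrangedHaar (m : ℤ) (I : DyadicInterval) (t : ℝ) : ℝ :=
  (I.shift m).toSet.indicator 1 t - I.toSet.indicator 1 t

theorem haar_eq (I : DyadicInterval) :
    I.haar = fun t => (Ico I.left (I.left + I.length / 2)).indicator (fun _ => (1 : ℝ)) t
      - (Ico (I.left + I.length / 2) (I.left + I.length)).indicator (fun _ => (1 : ℝ)) t := by
  have h := I.length_pos
  funext t
  simp only [haar, haarUnit, indicator, mem_Ico, Pi.one_apply, le_div_iff₀ h, div_lt_iff₀ h]
  congr 1 <;> congr 1 <;> apply propext <;> constructor <;> rintro ⟨h1, h2⟩ <;>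
    constructor <;> linarith

theorem memLp_haar_smul {X : Type*} [NormedAddCommGroup X] [NormedSpace ℝ X] (p : ℝ≥0∞)
    (I : DyadicInterval) (x : X) : MemLp (fun t => I.haar t • x) p volume := by
  rw [haar_eq]
  have h : ∀ a b : ℝ, MemLp ((Ico a b).indicator (fun _ => x)) p volume := fun a b =>
    memLp_indicator_const p measurableSet_Ico x (Or.inr (by simp))
  refine ((h I.left (I.left + I.length / 2)).sub
    (h (I.left + I.length / 2) (I.left + I.length))).congr_norm ?_ ?_
  · refine AEStronglyMeasurable.smul_const (AEStronglyMeasurable.sub ?_ ?_) x <;>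
      exact (aestronglyMeasurable_const.indicator measurableSet_Ico)
  · refine Filter.Eventually.of_forall fun t => ?_
    simp only [Pi.sub_apply, sub_smul, indicator]
    split_ifs <;> simp

theorem memLp_rearrangedHaar_smul {X : Type*} [NormedAddCommGroup X] [NormedSpace ℝ X]
    (p : ℝ≥0∞) (m : ℤ) (I : DyadicInterval) (x : X) :
    MemLp (fun t => rearrangedHaar m I t • x) p volume := by
  have h : ∀ J : DyadicInterval, MemLp (J.toSet.indicator (fun _ => x)) p volume := fun J =>
    memLp_indicator_const p J.measurableSet_toSet x (Or.inr (by simp [volume_toSet]))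
  refine ((h (I.shift m)).sub (h I)).congr_norm ?_ ?_
  · refine AEStronglyMeasurable.smul_const (AEStronglyMeasurable.sub ?_ ?_) x <;>
      exact (aestronglyMeasurable_const.indicator (measurableSet_toSet _))
  · refine Filter.Eventually.of_forall fun t => ?_
    simp only [rearrangedHaar, Pi.sub_apply, sub_smul, indicator, Pi.one_apply]
    split_ifs <;> simp

theorem haar_eq_floor (I : DyadicInterval) (t : ℝ) :
    I.haar t = if ⌊(2:ℝ)^(I.scale+1) * t⌋ = 2 * I.pos then 1 else
      if ⌊(2:ℝ)^(I.scale+1) * t⌋ = 2 * I.pos + 1 then -1 else 0 := by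
  have hp : (0:ℝ) < (2:ℝ)^I.scale := by positivity
  have e1 : (2:ℝ)^(I.scale+1) = 2 * 2^I.scale := by rw [zpow_add₀ (by norm_num)]; ring
  have key : (t - I.left) / I.length = 2^I.scale * t - I.pos := by
    simp only [left, length, zpow_neg]; field_simp
  simp only [haar, key, e1, haarUnit, Int.floor_eq_iff, indicator, mem_Ico, Pi.one_apply]
  push_cast
  set y := (2:ℝ)^I.scale * t
  have e2 : 2 * (2:ℝ)^I.scale * t = 2 * y := by ring
  rw [e2]
  split_ifs <;> grind

theorem floor_eq_of_haar_ne_zero (J : DyadicInterval) (t : ℝ) (h : J.haar t ≠ 0) : ⌊(2:ℝ)^J.scale * t⌋ = J.pos := by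
  rw [haar_eq_floor] at h
  have e1 : (2:ℝ)^(J.scale+1) = 2 * 2^J.scale := by rw [zpow_add₀ (by norm_num)]; ring
  rw [e1, mul_assoc] at h
  set y := (2:ℝ)^J.scale * t
  simp only [Int.floor_eq_iff] at h ⊢
  push_cast at h
  split_ifs at h <;> grind

theorem integral_haar (J : DyadicInterval) : ∫ t, J.haar t = 0 := by
  rw [haar_eq]
  have h := J.length_pos
  have hi : ∀ a b : ℝ, Integrable ((Ico a b).indicator (fun _ => (1 : ℝ))) volume := fun a b =>
    (integrable_indicator_iff measurableSet_Ico).2 (integrableOn_const (by simp) (by simp))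
  rw [integral_sub (hi _ _) (hi _ _), integral_indicator_const _ measurableSet_Ico, integral_indicator_const _ measurableSet_Ico]
  have e : J.length - J.length / 2 = J.length / 2 := by ring
  simp [Measure.real, Real.volume_Ico, e]

theorem haar_mul_of_lt (I J : DyadicInterval) (h : I.scale < J.scale) :
    ∃ c : ℝ, ∀ t, J.haar t * I.haar t = J.haar t * c := by
  obtain ⟨n, hn⟩ := Int.eq_ofNat_of_zero_le (by omega : 0 ≤ J.scale - (I.scale + 1))
  refine ⟨if J.pos / (2^n : ℕ) = 2 * I.pos then 1 else if J.pos / (2^n : ℕ) = 2 * I.pos + 1 then -1 else 0, fun t => ?_⟩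
  by_cases h0 : J.haar t = 0
  · simp [h0]
  have h1 := floor_eq_of_haar_ne_zero J t h0
  rw [haar_eq_floor I]
  have : ⌊(2:ℝ)^(I.scale+1) * t⌋ = J.pos / (2^n : ℕ) := by
    rw [← h1, ← Int.floor_div_natCast]
    congr 1
    rw [show J.scale = (I.scale+1) + n by omega, zpow_add₀ (by norm_num) _ (n : ℤ)]
    push_cast
    rw [zpow_natCast]; field_simp
  rw [this]

theorem integral_haar_mul_haar_of_ne (I J : DyadicInterval) (h : I ≠ J) : ∫ t, J.haar t * I.haar t = 0 := by
  rcases lt_trichotomy I.scale J.scale with h1 | h1 | h1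
  · obtain ⟨c, hc⟩ := haar_mul_of_lt I J h1
    simp [hc, integral_mul_const, integral_haar]
  · have : ∀ t, J.haar t * I.haar t = 0 := by
      intro t
      by_contra hh
      have a := floor_eq_of_haar_ne_zero J t (left_ne_zero_of_mul hh)
      have b := floor_eq_of_haar_ne_zero I t (right_ne_zero_of_mul hh)
      rw [h1] at b
      exact h (DyadicInterval.ext h1 (b.symm.trans a))
    simp [this]
  · obtain ⟨c, hc⟩ := haar_mul_of_lt J I h1
    simp_rw [mul_comm (J.haar _)]
    simp [hc, integral_mul_const, integral_haar]

theorem integral_haar_mul_self (I : DyadicInterval) : ∫ t, I.haar t * I.haar t = I.length := by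
  have h := I.length_pos
  have : ∀ t, I.haar t * I.haar t = (Ico I.left (I.left + I.length)).indicator (fun _ => (1:ℝ)) t := by
    intro t; rw [haar_eq]; simp only [indicator, mem_Ico]; split_ifs <;> grind
  simp_rw [this]
  rw [integral_indicator_const _ measurableSet_Ico]
  simp [Measure.real, Real.volume_Ico, h.le]

section Operators

variable {X : Type*} [NormedAddCommGroup X] [NormedSpace ℝ X] {p : ℝ≥0∞}

/-- The coefficient `⟨u, h_I⟩ = ∫ h_I(t) u(t) dt ∈ X`. -/
def haarCoeff (u : Lp X p (volume : Measure ℝ)) (I : DyadicInterval) : X :=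
  ∫ t, I.haar t • u t

/-- The term `⟨u, h_I⟩ h_I |I|⁻¹` of the Haar expansion of `u`, as an element of `L^p_X`. -/
def haarTerm (u : Lp X p (volume : Measure ℝ)) (I : DyadicInterval) :
    Lp X p (volume : Measure ℝ) :=
  I.length⁻¹ • (memLp_haar_smul p I (haarCoeff u I)).toLp

/-- The term `⟨v, h_I⟩ (U_m h_I) |I|⁻¹ = ⟨v, h_I⟩ (1_{τ_m(I)} - 1_I) |I|⁻¹` in `L^p_X`. -/
def rearrangedTerm (m : ℤ) (v : Lp X p (volume : Measure ℝ)) (I : DyadicInterval) :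
    Lp X p (volume : Measure ℝ) :=
  I.length⁻¹ • (memLp_rearrangedHaar_smul p m I (haarCoeff v I)).toLp

variable [Fact (1 ≤ p)]

/-- The Haar projection `u ↦ ∑_{I ∈ 𝓑} ⟨u, h_I⟩ h_I |I|⁻¹`, with the (unconditional) sum
taken in `L^p_X`. -/
def haarProj (𝓑 : Set DyadicInterval) (u : Lp X p (volume : Measure ℝ)) :
    Lp X p (volume : Measure ℝ) :=
  ∑' I : 𝓑, haarTerm u I

/-- The rearrangement operator `U_m`, that is `h_I ↦ 1_{τ_m(I)} - 1_I` extended to (convergent)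
Haar series: `U_m v = ∑_I ⟨v, h_I⟩ (1_{τ_m(I)} - 1_I) |I|⁻¹`. -/
def rearrangement (m : ℤ) (v : Lp X p (volume : Measure ℝ)) : Lp X p (volume : Measure ℝ) :=
  ∑' I : DyadicInterval, rearrangedTerm m v I

/-- `U_m (x h_I) = x (1_{τ_m(I)} - 1_I)` -/
theorem rearrangement_haar [CompleteSpace X] (m : ℤ) (I : DyadicInterval) (x : X) :
    rearrangement m (memLp_haar_smul p I x).toLp = (memLp_rearrangedHaar_smul p m I x).toLp := by
  have hc : ∀ J, haarCoeff (memLp_haar_smul p I x).toLp J = (∫ t, J.haar t * I.haar t) • x := by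
    intro J
    rw [haarCoeff, ← integral_smul_const]
    refine integral_congr_ae ?_
    filter_upwards [(memLp_haar_smul p I x).coeFn_toLp] with t ht
    rw [ht, smul_smul]
  have hJ : ∀ (J : DyadicInterval) (y z : X), y = z →
      (memLp_rearrangedHaar_smul p m J y).toLp = (memLp_rearrangedHaar_smul p m J z).toLp := by
    rintro J y z rfl; rfl
  rw [rearrangement, tsum_eq_single I]
  · rw [rearrangedTerm, ← MemLp.toLp_const_smul]
    refine MemLp.toLp_congr _ _ (Filter.Eventually.of_forall fun t => ?_)
    have := I.length_pos.ne'
    simp only [hc, integral_haar_mul_self, Pi.smul_apply]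
    rw [smul_comm, smul_smul _ _ x, inv_mul_cancel₀ this, one_smul]
  · intro J h
    have hz : (memLp_rearrangedHaar_smul p m J (0 : X)).toLp = 0 := by
      rw [Lp.eq_zero_iff_ae_eq_zero]
      filter_upwards [(memLp_rearrangedHaar_smul p m J (0 : X)).coeFn_toLp] with t ht
      rw [ht, smul_zero, Pi.zero_apply]
    rw [rearrangedTerm, hJ J _ 0 (by rw [hc, integral_haar_mul_haar_of_ne _ _ h.symm, zero_smul]), hz, smul_zero]

end Operators

/-! ### The splitting of the dyadic intervals for the shift width `m ≥ 1` -/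

/-- `λ`: the integer with `2^{λ-3} ≤ m < 2^{λ-2}` if `m ≥ 2`, and `λ = 4` if `m = 1`. -/
def splitGap (m : ℕ) : ℕ := if m = 1 then 4 else Nat.log 2 m + 3

theorem splitGap_spec (m : ℕ) (hm : 2 ≤ m) :
    4 ≤ splitGap m ∧ 2 ^ (splitGap m - 3) ≤ m ∧ m < 2 ^ (splitGap m - 2) := by
  have h : splitGap m = Nat.log 2 m + 3 := if_neg (by omega)
  rw [h]
  refine ⟨?_, ?_, ?_⟩
  · have := Nat.log_pos (b := 2) (by norm_num) hm
    omega
  · simpa using Nat.pow_log_le_self 2 (by omega : m ≠ 0)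
  · simpa using Nat.lt_pow_succ_log_self (b := 2) (by norm_num) m

/-- `L(m) = λ - 1` -/
def lastLevel (m : ℕ) : ℕ := splitGap m - 1

/-- `K(m) = 2 L(m) + 1` -/
def lastIndex (m : ℕ) : ℕ := 2 * lastLevel m + 1

/-- `𝒜_i`: the dyadic intervals of length `2^{-(λ j + i)}`, `j ∈ ℤ`. -/
def levelColl (m i : ℕ) : Set DyadicInterval :=
  {I | ∃ j : ℤ, I.scale = splitGap m * j + i}

/-- `𝒜_i^{(0)}`: those `J ∈ 𝒜_i` for which some `I ∈ 𝒜_i` with `|J| = 2^{-λ} |I|` contains both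
`J` and `τ_m(J)`. -/
def levelColl₀ (m i : ℕ) : Set DyadicInterval :=
  {J | J ∈ levelColl m i ∧ ∃ I ∈ levelColl m i,
    J.length = (2 : ℝ) ^ (-(splitGap m : ℤ)) * I.length ∧
      J.toSet ⊆ I.toSet ∧ (J.shift m).toSet ⊆ I.toSet}

/-- `𝒜_i^{(1)} = 𝒜_i \ 𝒜_i^{(0)}` -/
def levelColl₁ (m i : ℕ) : Set DyadicInterval := levelColl m i \ levelColl₀ m i

/-- `ℰ = {τ_k(I) : inf I = 0, 0 ≤ k ≤ m - 1}` -/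
def baseBlock (m : ℕ) : Set DyadicInterval :=
  {J | ∃ I : DyadicInterval, I.left = 0 ∧ ∃ k : ℕ, k < m ∧ J = I.shift k}

/-- `𝒟_even`: the union of the `τ_{jm}(ℰ)` over even `j ∈ ℤ`. -/
def evenColl (m : ℕ) : Set DyadicInterval :=
  ⋃ j ∈ {j : ℤ | Even j}, shift (j * m) '' baseBlock m

/-- `𝒟_odd`: the union of the `τ_{jm}(ℰ)` over odd `j ∈ ℤ`. -/
def oddColl (m : ℕ) : Set DyadicInterval :=
  ⋃ j ∈ {j : ℤ | Odd j}, shift (j * m) '' baseBlock m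

/-- `ℬ_i^{(0)}`, `0 ≤ i ≤ K(m)`: it is `𝒜_i^{(0)} ∩ 𝒟_even` for `i ≤ L(m)`, and
`ℬ_{i+L(m)+1}^{(0)} = 𝒜_i^{(0)} ∩ 𝒟_odd`. -/
def splitColl₀ (m i : ℕ) : Set DyadicInterval :=
  if i ≤ lastLevel m then levelColl₀ m i ∩ evenColl m
  else levelColl₀ m (i - (lastLevel m + 1)) ∩ oddColl m

/-- `ℬ_i^{(1)}`, `0 ≤ i ≤ K(m)`, defined in the same way from `𝒜_i^{(1)}`. -/
def splitColl₁ (m i : ℕ) : Set DyadicInterval :=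
  if i ≤ lastLevel m then levelColl₁ m i ∩ evenColl m
  else levelColl₁ m (i - (lastLevel m + 1)) ∩ oddColl m

/-- `ℬ_i^{(1,0)}`: those `I ∈ ℬ_i^{(1)}` with `inf τ_m(I) ≠ inf pred^λ(τ_m(I))`. -/
def splitColl₁₀ (m i : ℕ) : Set DyadicInterval :=
  {I | I ∈ splitColl₁ m i ∧ (I.shift m).left ≠ (pred^[splitGap m] (I.shift m)).left}

/-- `ℬ_i^{(1,1)}`: those `I ∈ ℬ_i^{(1)}` with `inf τ_m(I) = inf pred^λ(τ_m(I))`. -/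
def splitColl₁₁ (m i : ℕ) : Set DyadicInterval :=
  {I | I ∈ splitColl₁ m i ∧ (I.shift m).left = (pred^[splitGap m] (I.shift m)).left}

end DyadicInterval

end

/-!
Write `g_I = 1_{τ_m(I)} - 1_I` for the image of the Haar function `h_I` under `U_m`. For finitely
many intervals `I` of one of the collections `𝓑`, the point is to get from `∑ x_I h_I` to
`∑ x_I g_I` by a bounded number of martingale transforms, each of which costs a factor
`β = 𝒰_p(X) + 1`.

*Martingales without filtrations.* If functions `d_0, d_1, …` of bounded support and mean zero are
such that every `d_j` is constant on the support of every later `d_k`, then `(x_k d_k)` is a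
martingale difference sequence with respect to the events that contain or miss the support of
all later `d_k` (`isMartingaleDiffSeq_tree`). So the UMD property applies as soon as the smaller
functions do not see the larger ones vary (`eLpNorm_ranked_transform_le`).

*Moving mass.* Let `a, b, d` be disjoint sets of equal measure attached to `I`. Averaging over
`b ∪ d` first and separating `b` from `d` afterwards exhibits `1_a - 1_d` as a transform of
`1_a - 1_b` (`sumNorm_swap_le`). In the same way `1_a - 1_b` controls the function that spreads a
multiple of `1_a` over `I \ (a ∪ b)` (`sumNorm_spread_le`). Let `a` lie in the left half and `b` in
the right half of `I`, and let `a' = τ(a)`, `b' = τ(b)` be their translates in `τ_m(I)`. Then `h_I`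
controls `1_a - 1_b`, which controls `1_{a'} - 1_a` and `1_{b'} - 1_b` by swaps across
`I ∪ τ_m(I)`, and `1_I` and `1_{τ_m(I)}` are recovered from `a` and `a'` by spreading inside `I` and
inside `τ_m(I)` separately (`sumNorm_shift_le`). The only condition that involves unions
`J ∪ τ_m(J)` of smaller intervals is that these are not cut by the endpoints of `a, b, a', b'`.

*Choice of `a` and `b`.* Lengths in `𝒜_i` are separated by a factor `2 ^ λ > 4 m`, and the parity
condition makes the sets `J ∪ τ_m(J)` of the same size disjoint. If `J` and `τ_m(J)` lie in different
intervals of length `2 ^ λ |J|`, then `J ∪ τ_m(J)` is within a quarter of that length of a dyadic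
endpoint, while the points of `I` at `4/12, 5/12, 7/12, 8/12` stay away from all such endpoints,
thirds of dyadic intervals being never close to dyadic points of comparable scale
(`isShiftCompatible_of_level₁`). If they lie in the same interval `Q`, the choice of `a` and `b`
as eighths of `I` makes `Q` itself the only interval of concern; as `J ∪ τ_m(J)` has at most a
quarter of the length of `Q`, it misses both outer eighths or both of the eighths next to the
midpoint, and the collection is split accordingly (`isShiftCompatible_central`,
`isShiftCompatible_not_central`).

*Series.* The finite Haar sums are dense in `L^p_X` for `1 < p < ∞` (`denseRange_haarSum`), and the
projections onto finite sets of Haar functions are uniformly bounded, so Haar series converge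
unconditionally (`summable_haarTerm`) and the finite estimate passes to the limit.
-/

namespace FigielShift

open DyadicInterval

/-! ### Tree-like sequences as martingale difference sequences -/

/-- `f` takes a single value on `S`. -/
def ConstOn (f : ℝ → ℝ) (S : Set ℝ) : Prop := ∀ s ∈ S, ∀ t ∈ S, f s = f t

theorem ConstOn.mono {f : ℝ → ℝ} {S T : Set ℝ} (h : ConstOn f T) (hST : S ⊆ T) : ConstOn f S :=
  fun s hs t ht => h s (hST hs) t (hST ht)

/-- A bounded measurable function of bounded support. -/
structure IsBddFun (f : ℝ → ℝ) : Prop where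
  measurable : Measurable f
  bounded : ∃ C, ∀ t, |f t| ≤ C
  support_bounded : ∃ R, ∀ t, f t ≠ 0 → |t| ≤ R

/-- A block: a bounded measurable function of bounded support and mean zero. -/
structure IsBlock (f : ℝ → ℝ) : Prop extends IsBddFun f where
  integral_eq_zero : ∫ t, f t = 0

theorem isBlock_zero : IsBlock 0 where
  measurable := measurable_const
  bounded := ⟨0, by simp⟩
  support_bounded := ⟨0, by simp⟩
  integral_eq_zero := by simp

namespace IsBddFun

variable {f g : ℝ → ℝ}

theorem add (hf : IsBddFun f) (hg : IsBddFun g) : IsBddFun (f + g) := by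
  obtain ⟨hf1, ⟨C, hC⟩, ⟨R, hR⟩⟩ := hf
  obtain ⟨hg1, ⟨C', hC'⟩, ⟨R', hR'⟩⟩ := hg
  refine ⟨hf1.add hg1, ⟨C + C', fun t => (abs_add_le _ _).trans (add_le_add (hC t) (hC' t))⟩,
    ⟨max R R', fun t ht => ?_⟩⟩
  by_cases h : f t = 0
  · exact (hR' t fun h' => ht (by simp [h, h'])).trans (le_max_right _ _)
  · exact (hR t h).trans (le_max_left _ _)

theorem const_smul (hf : IsBddFun f) (c : ℝ) : IsBddFun (c • f) := by
  obtain ⟨hf1, ⟨C, hC⟩, ⟨R, hR⟩⟩ := hf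
  refine ⟨hf1.const_smul c, ⟨|c| * C, fun t => ?_⟩, ⟨R, fun t ht => hR t fun h => ht ?_⟩⟩
  · rw [Pi.smul_apply, smul_eq_mul, abs_mul]
    exact mul_le_mul_of_nonneg_left (hC t) (abs_nonneg c)
  · rw [Pi.smul_apply, h, smul_zero]

theorem sub (hf : IsBddFun f) (hg : IsBddFun g) : IsBddFun (f - g) := by
  have := hf.add (hg.const_smul (-1))
  rwa [neg_one_smul, ← sub_eq_add_neg] at this

theorem indicator_one {S : Set ℝ} (hS : MeasurableSet S) (hb : ∃ R, ∀ t ∈ S, |t| ≤ R) :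
    IsBddFun (S.indicator 1) := by
  obtain ⟨R, hR⟩ := hb
  refine ⟨measurable_one.indicator hS, ⟨1, fun t => ?_⟩, ⟨R, fun t ht => hR t ?_⟩⟩
  · by_cases h : t ∈ S <;> simp [h]
  · exact mem_of_indicator_ne_zero ht

theorem integrable (hf : IsBddFun f) : Integrable f := by
  obtain ⟨hf1, ⟨C, hC⟩, ⟨R, hR⟩⟩ := hf
  rw [← integrableOn_iff_integrable_of_support_subset (s := Icc (-R) R)
    fun t ht => abs_le.1 (hR t ht)]
  exact Measure.integrableOn_of_bounded (by simp) hf1.aestronglyMeasurable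
    (Filter.Eventually.of_forall hC)

theorem integral_add (hf : IsBddFun f) (hg : IsBddFun g) :
    ∫ t, (f + g) t = (∫ t, f t) + ∫ t, g t := MeasureTheory.integral_add hf.integrable hg.integrable

theorem integral_sub (hf : IsBddFun f) (hg : IsBddFun g) :
    ∫ t, (f - g) t = (∫ t, f t) - ∫ t, g t := MeasureTheory.integral_sub hf.integrable hg.integrable

theorem integral_const_smul (c : ℝ) : ∫ t, (c • f) t = c * ∫ t, f t := integral_const_mul c f

end IsBddFun

section Transform

variable {X : Type*} [NormedAddCommGroup X] [NormedSpace ℝ X] {p β : ℝ≥0∞}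

theorem memLp_smul_const_of_bounded {μ : Measure ℝ} [IsFiniteMeasure μ] {f : ℝ → ℝ}
    (hf : Measurable f) (hb : ∃ C, ∀ t, |f t| ≤ C) (x : X) : MemLp (fun t => f t • x) p μ := by
  obtain ⟨C, hC⟩ := hb
  refine MemLp.of_bound (hf.aestronglyMeasurable.smul_const x) (C * ‖x‖)
    (Filter.Eventually.of_forall fun t => ?_)
  rw [norm_smul]
  exact mul_le_mul_of_nonneg_right (hC t) (norm_nonneg _)

variable [CompleteSpace X]

/-- The events which are decided by time `n`: they contain the support of every later `d k`, or
miss it. Under the tree condition the sequence `d` is a martingale difference sequence with respect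
to this filtration. -/
def treeFiltration (d : ℕ → ℝ → ℝ) : Filtration ℕ (inferInstance : MeasurableSpace ℝ) where
  seq n :=
    { MeasurableSet' := fun s => MeasurableSet s ∧
        ∀ k, n < k → Function.support (d k) ⊆ s ∨ Disjoint (Function.support (d k)) s
      measurableSet_empty := ⟨MeasurableSet.empty, fun k _ => Or.inr (disjoint_empty _)⟩
      measurableSet_compl := fun s hs => ⟨hs.1.compl, fun k hk => (hs.2 k hk).symm.imp
        (fun h => h.subset_compl_right) (fun h => disjoint_compl_right_iff_subset.2 h)⟩
      measurableSet_iUnion := fun s hs => ⟨MeasurableSet.iUnion fun i => (hs i).1, fun k hk => by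
        by_cases h : ∃ i, Function.support (d k) ⊆ s i
        · obtain ⟨i, hi⟩ := h
          exact Or.inl (hi.trans (subset_iUnion s i))
        · push Not at h
          exact Or.inr (disjoint_iUnion_right.2 fun i => ((hs i).2 k hk).resolve_left (h i))⟩ }
  mono' _ _ hij _ hs := ⟨hs.1, fun k hk => hs.2 k (lt_of_le_of_lt hij hk)⟩
  le' _ _ hs := hs.1

theorem setIntegral_tree_eq_zero {d : ℕ → ℝ → ℝ} {μ : Measure ℝ} {n : ℕ} {s : Set ℝ}
    (hs : MeasurableSet[treeFiltration d n] s) (x : X) (h0 : ∫ t, d (n + 1) t ∂μ = 0) :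
    ∫ t in s, d (n + 1) t • x ∂μ = 0 := by
  have h1 : MeasurableSet s := hs.1
  rcases hs.2 (n + 1) (Nat.lt_succ_self n) with h | h
  · rw [setIntegral_eq_integral_of_forall_compl_eq_zero, integral_smul_const, h0, zero_smul]
    intro t ht
    have : d (n + 1) t = 0 := by
      by_contra hne
      exact ht (h hne)
    rw [this, zero_smul]
  · refine setIntegral_eq_zero_of_forall_eq_zero fun t ht => ?_
    have : d (n + 1) t = 0 := by
      by_contra hne
      exact (disjoint_left.1 h hne) ht
    rw [this, zero_smul]

theorem isMartingaleDiffSeq_tree {μ : Measure ℝ} [IsFiniteMeasure μ] {d : ℕ → ℝ → ℝ}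
    (hm : ∀ k, Measurable (d k)) (hb : ∀ k, ∃ C, ∀ t, |d k t| ≤ C)
    (h0 : ∀ k, ∫ t, d k t ∂μ = 0)
    (htree : ∀ j k, j < k → ConstOn (d j) (Function.support (d k))) (x : ℕ → X) :
    IsMartingaleDiffSeq p (fun k t => d k t • x k) (treeFiltration d) μ where
  adapted n := by
    have : Measurable[treeFiltration d n] (d n) := by
      intro s hs
      refine ⟨hm n hs, fun k hk => ?_⟩
      by_cases h : ∃ t ∈ Function.support (d k), d n t ∈ s
      · obtain ⟨t, ht, hts⟩ := h
        refine Or.inl fun t' ht' => ?_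
        rw [mem_preimage, htree n k hk t' ht' t ht]
        exact hts
      · push Not at h
        exact Or.inr (disjoint_left.2 h)
    exact this.stronglyMeasurable.smul_const (x n)
  memLp n := memLp_smul_const_of_bounded (hm n) (hb n) (x n)
  condExp_eq_zero n := by
    symm
    refine ae_eq_condExp_of_forall_setIntegral_eq ((treeFiltration d).le n)
      (memLp_one_iff_integrable.1 (memLp_smul_const_of_bounded (hm _) (hb _) (x _)))
      (fun s _ _ => integrableOn_zero) (fun s hs _ => ?_) aestronglyMeasurable_zero
    rw [setIntegral_tree_eq_zero hs _ (h0 _)]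
    simp

/-- Sign changes of a sequence of blocks each of which is constant on the supports of the
later ones. -/
theorem eLpNorm_tree_transform_le (hp : p ≠ ∞) (hβ : IsUMDBound p X β) {d : ℕ → ℝ → ℝ}
    (hd : ∀ k, IsBlock (d k)) {R : ℝ} (hR : ∀ k t, d k t ≠ 0 → |t| ≤ R)
    (htree : ∀ j k, j < k → ConstOn (d j) (Function.support (d k))) (x : ℕ → X) (ε : ℕ → ℝ)
    (hε : ∀ j, ε j = 1 ∨ ε j = -1) (n : ℕ) :
    eLpNorm (fun t => ∑ j ∈ Finset.range n, ε j • d j t • x j) p volume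
      ≤ β * eLpNorm (fun t => ∑ j ∈ Finset.range n, d j t • x j) p volume := by
  -- The probability space is an interval containing all supports, with normalized measure; the
  -- normalization multiplies both sides by the same power of its length.
  set B : Set ℝ := Icc (-(|R| + 1)) (|R| + 1) with hB
  have hBv : volume B = ENNReal.ofReal (2 * |R| + 2) := by
    rw [hB, Real.volume_Icc]; congr 1; ring
  have hv0 : volume B ≠ 0 := by
    rw [hBv, Ne, ENNReal.ofReal_eq_zero, not_le]; positivity
  have hvt : volume B ≠ ∞ := by rw [hBv]; exact ENNReal.ofReal_ne_top
  have hdB : ∀ k t, t ∉ B → d k t = 0 := by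
    intro k t ht
    by_contra hne
    have h1 := (hR k t hne).trans (le_abs_self R)
    exact ht ⟨by linarith [(abs_le.1 h1).1], by linarith [(abs_le.1 h1).2]⟩
  set c : ℝ≥0∞ := (volume B)⁻¹ with hc
  have hc0 : c ≠ 0 := ENNReal.inv_ne_zero.2 hvt
  have hct : c ≠ ∞ := ENNReal.inv_ne_top.2 hv0
  set μ : Measure ℝ := c • volume.restrict B with hμ
  have hprob : IsProbabilityMeasure μ := ⟨by
    simp [hμ, hc, ENNReal.inv_mul_cancel hv0 hvt]⟩
  have h0 : ∀ k, ∫ t, d k t ∂μ = 0 := by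
    intro k
    rw [hμ, integral_smul_measure, setIntegral_eq_integral_of_forall_compl_eq_zero (hdB k),
      (hd k).integral_eq_zero, smul_zero]
  have key := hβ ℝ _ μ hprob (treeFiltration d) (fun k t => d k t • x k)
    (isMartingaleDiffSeq_tree (fun k => (hd k).measurable) (fun k => (hd k).bounded) h0 htree x)
    ε hε n
  have hnorm : ∀ f : ℝ → X, (∀ t, t ∉ B → f t = 0) →
      eLpNorm f p μ = c ^ (1 / p).toReal * eLpNorm f p volume := by
    intro f hf
    rw [hμ, eLpNorm_smul_measure_of_ne_top hp, smul_eq_mul,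
      eLpNorm_restrict_eq_of_support_subset]
    intro t ht
    by_contra htB
    exact ht (hf t htB)
  rw [hnorm _ fun t ht => Finset.sum_eq_zero fun j _ => by rw [hdB j t ht, zero_smul, smul_zero],
    hnorm _ fun t ht => Finset.sum_eq_zero fun j _ => by rw [hdB j t ht, zero_smul],
    mul_left_comm] at key
  refine (ENNReal.mul_le_mul_iff_right ?_ ?_).1 key
  · exact (ENNReal.rpow_pos (pos_iff_ne_zero.2 hc0) hct).ne'
  · exact ENNReal.rpow_ne_top_of_nonneg ENNReal.toReal_nonneg hct

/-- Sign changes of a finite family of blocks, ordered by a rank, in which every block is constant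
on the supports of the other blocks of at least its rank. -/
theorem eLpNorm_ranked_transform_le (hp : p ≠ ∞) (hβ : IsUMDBound p X β) {ι : Type*} [Fintype ι]
    {d : ι → ℝ → ℝ} (hd : ∀ i, IsBlock (d i)) (rank : ι → ℤ)
    (htree : ∀ i j, i ≠ j → rank i ≤ rank j → ConstOn (d i) (Function.support (d j)))
    (x : ι → X) (ε : ι → ℝ) (hε : ∀ i, ε i = 1 ∨ ε i = -1) :
    eLpNorm (fun t => ∑ i, ε i • d i t • x i) p volume
      ≤ β * eLpNorm (fun t => ∑ i, d i t • x i) p volume := by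
  set n := Fintype.card ι
  let e0 : Fin n ≃ ι := (Fintype.equivFin ι).symm
  -- enumerate the family by increasing rank
  let e : Fin n ≃ ι := (Tuple.sort (rank ∘ e0)).trans e0
  have he : Monotone (rank ∘ e) := Tuple.monotone_sort (rank ∘ e0)
  choose R hR using fun i => (hd i).support_bounded
  let D : ℕ → ℝ → ℝ := fun k => if h : k < n then d (e ⟨k, h⟩) else 0
  let x' : ℕ → X := fun k => if h : k < n then x (e ⟨k, h⟩) else 0
  let ε' : ℕ → ℝ := fun k => if h : k < n then ε (e ⟨k, h⟩) else 1
  have key := eLpNorm_tree_transform_le hp hβ (d := D) (R := ∑ i, |R i|) ?_ ?_ ?_ x' ε' ?_ n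
  · have e1 : ∀ t, ∑ j ∈ Finset.range n, ε' j • D j t • x' j = ∑ i, ε i • d i t • x i := by
      intro t
      rw [Finset.sum_range, ← e.sum_comp]
      exact Finset.sum_congr rfl fun j _ => by simp [ε', D, x', j.2]
    have e2 : ∀ t, ∑ j ∈ Finset.range n, D j t • x' j = ∑ i, d i t • x i := by
      intro t
      rw [Finset.sum_range, ← e.sum_comp]
      exact Finset.sum_congr rfl fun j _ => by simp [D, x', j.2]
    simpa only [e1, e2] using key
  · intro k
    by_cases h : k < n
    · simpa [D, h] using hd _
    · simpa [D, h] using isBlock_zero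
  · intro k t ht
    by_cases h : k < n
    · simp only [D, h, dif_pos] at ht
      refine (hR _ t ht).trans ((le_abs_self _).trans ?_)
      exact Finset.single_le_sum (f := fun i => |R i|) (fun i _ => abs_nonneg _)
        (Finset.mem_univ _)
    · simp [D, h] at ht
  · intro j k hjk
    by_cases h : k < n
    · have hj : j < n := hjk.trans h
      simp only [D, h, hj, dif_pos]
      refine htree _ _ ?_ (he (a := ⟨j, hj⟩) (b := ⟨k, h⟩) hjk.le)
      intro hh
      have := e.injective hh
      simp only [Fin.mk.injEq] at this
      omega
    · simp [D, h, ConstOn]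
  · intro j
    by_cases h : j < n
    · simpa [ε', h] using hε _
    · simp [ε', h]

end Transform

/-! ### Moving mass by martingale transforms -/

namespace ConstOn

variable {f g : ℝ → ℝ} {S : Set ℝ}

theorem add (hf : ConstOn f S) (hg : ConstOn g S) : ConstOn (f + g) S :=
  fun s hs t ht => congrArg₂ (· + ·) (hf s hs t ht) (hg s hs t ht)

theorem sub (hf : ConstOn f S) (hg : ConstOn g S) : ConstOn (f - g) S :=
  fun s hs t ht => congrArg₂ (· - ·) (hf s hs t ht) (hg s hs t ht)

theorem const_smul (hf : ConstOn f S) (c : ℝ) : ConstOn (c • f) S :=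
  fun s hs t ht => congrArg (c • ·) (hf s hs t ht)

end ConstOn

section Families

variable {ι : Type*}

/-- Each `f i` is constant on every other `S j` of at least its rank. -/
def ConstOnFiner (rank : ι → ℤ) (S : ι → Set ℝ) (f : ι → ℝ → ℝ) : Prop :=
  ∀ i j, i ≠ j → rank i ≤ rank j → ConstOn (f i) (S j)

namespace ConstOnFiner

variable {rank : ι → ℤ} {S T : ι → Set ℝ} {f g : ι → ℝ → ℝ}

theorem mono (hf : ConstOnFiner rank T f) (h : ∀ i, S i ⊆ T i) : ConstOnFiner rank S f :=
  fun i j hij hr => (hf i j hij hr).mono (h j)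

theorem add (hf : ConstOnFiner rank S f) (hg : ConstOnFiner rank S g) :
    ConstOnFiner rank S (f + g) := fun i j hij hr => (hf i j hij hr).add (hg i j hij hr)

theorem sub (hf : ConstOnFiner rank S f) (hg : ConstOnFiner rank S g) :
    ConstOnFiner rank S (f - g) := fun i j hij hr => (hf i j hij hr).sub (hg i j hij hr)

theorem const_smul (hf : ConstOnFiner rank S f) (c : ℝ) : ConstOnFiner rank S (c • f) :=
  fun i j hij hr => (hf i j hij hr).const_smul c

end ConstOnFiner

/-- The family of the indicator functions of the sets `a i`. -/
noncomputable def ind (a : ι → Set ℝ) : ι → ℝ → ℝ := fun i => (a i).indicator 1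

variable {X : Type*} [NormedAddCommGroup X] [NormedSpace ℝ X] {p β : ℝ≥0∞} [Fintype ι]

/-- The `L^p` norm of `∑ i, f i ⊗ x i`. -/
noncomputable def sumNorm (p : ℝ≥0∞) (x : ι → X) (f : ι → ℝ → ℝ) : ℝ≥0∞ :=
  eLpNorm (fun t => ∑ i, f i t • x i) p volume

theorem sumNorm_add_le (hp1 : 1 ≤ p) (x : ι → X) {f g : ι → ℝ → ℝ} (hf : ∀ i, Measurable (f i))
    (hg : ∀ i, Measurable (g i)) : sumNorm p x (f + g) ≤ sumNorm p x f + sumNorm p x g := by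
  have hm : ∀ {f : ι → ℝ → ℝ}, (∀ i, Measurable (f i)) →
      AEStronglyMeasurable (fun t => ∑ i, f i t • x i) volume := fun hf =>
    Finset.aestronglyMeasurable_fun_sum _ fun i _ => (hf i).aestronglyMeasurable.smul_const (x i)
  refine le_of_eq_of_le ?_ (eLpNorm_add_le (hm hf) (hm hg) hp1)
  unfold sumNorm
  congr 1
  funext t
  simp [add_smul, Finset.sum_add_distrib]

theorem sumNorm_const_smul (x : ι → X) (f : ι → ℝ → ℝ) (c : ℝ) :
    sumNorm p x (c • f) = ‖c‖ₑ * sumNorm p x f := by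
  unfold sumNorm
  rw [← eLpNorm_const_smul]
  congr 1
  funext t
  simp [Finset.smul_sum, smul_smul]

theorem sumNorm_neg (x : ι → X) (f : ι → ℝ → ℝ) : sumNorm p x (-f) = sumNorm p x f := by
  rw [← neg_one_smul ℝ f, sumNorm_const_smul]
  simp

theorem sumNorm_sub_le (hp1 : 1 ≤ p) (x : ι → X) {f g : ι → ℝ → ℝ} (hf : ∀ i, Measurable (f i))
    (hg : ∀ i, Measurable (g i)) : sumNorm p x (f - g) ≤ sumNorm p x f + sumNorm p x g := by
  rw [sub_eq_add_neg, ← sumNorm_neg x g]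
  exact sumNorm_add_le hp1 x hf fun i => (hg i).neg

variable [CompleteSpace X]

/-- If `A i`, `B i` can be added to a martingale one after the other, `B i` refining `A i`, then
`∑ (A i - B i) ⊗ x i` is a martingale transform of `∑ (A i + B i) ⊗ x i`. -/
theorem sumNorm_sub_le_sumNorm_add (hp : p ≠ ∞) (hβ : IsUMDBound p X β) {A B : ι → ℝ → ℝ}
    (hA : ∀ i, IsBlock (A i)) (hB : ∀ i, IsBlock (B i)) {S : ι → Set ℝ}
    (hAS : ∀ i, Function.support (A i) ⊆ S i) (hBS : ∀ i, Function.support (B i) ⊆ S i)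
    (hAB : ∀ i, ConstOn (A i) (Function.support (B i))) {rank : ι → ℤ}
    (hA' : ConstOnFiner rank S A) (hB' : ConstOnFiner rank S B) (x : ι → X) :
    sumNorm p x (A - B) ≤ β * sumNorm p x (A + B) := by
  -- between two ranks, all the `A i` come before all the `B i`
  let d : ι × Bool → ℝ → ℝ := fun k => if k.2 then B k.1 else A k.1
  have key := eLpNorm_ranked_transform_le hp hβ (d := d) (fun k => ?_)
    (fun k => 2 * rank k.1 + if k.2 then 1 else 0) ?_ (fun k => x k.1)
    (fun k => if k.2 then -1 else 1) (fun k => ?_)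
  · refine le_of_eq_of_le ?_ (key.trans_eq ?_)
    · unfold sumNorm
      congr 1
      funext t
      simp only [Fintype.sum_prod_type, Fintype.sum_bool, d]
      refine Finset.sum_congr rfl fun i _ => ?_
      simp [sub_smul]
      abel
    · unfold sumNorm
      congr 2
      funext t
      simp only [Fintype.sum_prod_type, Fintype.sum_bool, d]
      refine Finset.sum_congr rfl fun i _ => ?_
      simp [add_smul]
      abel
  · obtain ⟨i, b⟩ := k
    cases b <;> simp [d, hA, hB]
  · rintro ⟨i, b⟩ ⟨j, b'⟩ hne hr
    by_cases hij : i = j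
    · subst hij
      cases b <;> cases b' <;> simp [d] at hne hr ⊢
      exact hAB i
    · have hr' : rank i ≤ rank j := by
        cases b <;> cases b' <;> simp at hr <;> omega
      have h1 : Function.support (d (j, b')) ⊆ S j := by
        cases b' <;> simp [d, hAS, hBS]
      refine ConstOn.mono ?_ h1
      cases b
      · simpa [d] using hA' i j hij hr'
      · simpa [d] using hB' i j hij hr'
  · obtain ⟨i, b⟩ := k
    cases b <;> simp

/-- The first terms of a two-step martingale are bounded by the whole of it. -/
theorem sumNorm_left_le_sumNorm_add (hp1 : 1 ≤ p) (hp : p ≠ ∞) (hβ : IsUMDBound p X β)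
    (hβ1 : 1 ≤ β) {A B : ι → ℝ → ℝ}
    (hA : ∀ i, IsBlock (A i)) (hB : ∀ i, IsBlock (B i)) {S : ι → Set ℝ}
    (hAS : ∀ i, Function.support (A i) ⊆ S i) (hBS : ∀ i, Function.support (B i) ⊆ S i)
    (hAB : ∀ i, ConstOn (A i) (Function.support (B i))) {rank : ι → ℤ}
    (hA' : ConstOnFiner rank S A) (hB' : ConstOnFiner rank S B) (x : ι → X) :
    sumNorm p x A ≤ β * sumNorm p x (A + B) := by
  have h := sumNorm_sub_le_sumNorm_add hp hβ hA hB hAS hBS hAB hA' hB' x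
  have e : A = (2⁻¹ : ℝ) • ((A + B) + (A - B)) := by
    rw [add_add_sub_cancel, ← two_smul ℝ A, smul_smul]
    norm_num
  have h2 : ‖(2⁻¹ : ℝ)‖ₑ = 2⁻¹ := by
    rw [enorm_inv (by norm_num)]
    norm_num [enorm_eq_nnnorm]
  have hm : ∀ i, Measurable ((A + B) i) := fun i => (hA i).measurable.add (hB i).measurable
  have hm' : ∀ i, Measurable ((A - B) i) := fun i => (hA i).measurable.sub (hB i).measurable
  calc sumNorm p x A = 2⁻¹ * sumNorm p x ((A + B) + (A - B)) := by
        rw [← h2, ← sumNorm_const_smul, ← e]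
    _ ≤ 2⁻¹ * (sumNorm p x (A + B) + sumNorm p x (A - B)) := by
        gcongr; exact sumNorm_add_le hp1 x hm hm'
    _ ≤ 2⁻¹ * (β * sumNorm p x (A + B) + β * sumNorm p x (A + B)) := by
        gcongr; exact le_mul_of_one_le_left zero_le hβ1
    _ = β * sumNorm p x (A + B) := by
        rw [← two_mul, ← mul_assoc, ENNReal.inv_mul_cancel (by norm_num) (by norm_num), one_mul]

/-- The second terms of a two-step martingale are bounded by the whole of it. -/
theorem sumNorm_right_le_sumNorm_add (hp1 : 1 ≤ p) (hp : p ≠ ∞) (hβ : IsUMDBound p X β)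
    (hβ1 : 1 ≤ β) {A B : ι → ℝ → ℝ}
    (hA : ∀ i, IsBlock (A i)) (hB : ∀ i, IsBlock (B i)) {S : ι → Set ℝ}
    (hAS : ∀ i, Function.support (A i) ⊆ S i) (hBS : ∀ i, Function.support (B i) ⊆ S i)
    (hAB : ∀ i, ConstOn (A i) (Function.support (B i))) {rank : ι → ℤ}
    (hA' : ConstOnFiner rank S A) (hB' : ConstOnFiner rank S B) (x : ι → X) :
    sumNorm p x B ≤ β * sumNorm p x (A + B) := by
  have h := sumNorm_sub_le_sumNorm_add hp hβ hA hB hAS hBS hAB hA' hB' x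
  have e : B = (2⁻¹ : ℝ) • ((A + B) - (A - B)) := by
    rw [add_sub_sub_cancel, ← two_smul ℝ B, smul_smul]
    norm_num
  have h2 : ‖(2⁻¹ : ℝ)‖ₑ = 2⁻¹ := by
    rw [enorm_inv (by norm_num)]
    norm_num [enorm_eq_nnnorm]
  have hm : ∀ i, Measurable ((A + B) i) := fun i => (hA i).measurable.add (hB i).measurable
  have hm' : ∀ i, Measurable ((A - B) i) := fun i => (hA i).measurable.sub (hB i).measurable
  calc sumNorm p x B = 2⁻¹ * sumNorm p x ((A + B) - (A - B)) := by
        rw [← h2, ← sumNorm_const_smul, ← e]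
    _ ≤ 2⁻¹ * (sumNorm p x (A + B) + sumNorm p x (A - B)) := by
        gcongr; exact sumNorm_sub_le hp1 x hm hm'
    _ ≤ 2⁻¹ * (β * sumNorm p x (A + B) + β * sumNorm p x (A + B)) := by
        gcongr; exact le_mul_of_one_le_left zero_le hβ1
    _ = β * sumNorm p x (A + B) := by
        rw [← two_mul, ← mul_assoc, ENNReal.inv_mul_cancel (by norm_num) (by norm_num), one_mul]

/-- A bounded measurable set. -/
structure IsPiece (a : Set ℝ) : Prop where
  measurableSet : MeasurableSet a
  bounded : ∃ R, ∀ t ∈ a, |t| ≤ R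

theorem IsPiece.isBddFun {a : Set ℝ} (h : IsPiece a) : IsBddFun (a.indicator 1) :=
  IsBddFun.indicator_one h.measurableSet h.bounded

theorem IsPiece.integral {a : Set ℝ} (h : IsPiece a) :
    ∫ t, a.indicator (1 : ℝ → ℝ) t = volume.real a := integral_indicator_one h.measurableSet

/-- From `1_a - 1_b` to `1_a - 1_d` for disjoint sets of equal measure: average over `b ∪ d`
first, then separate `b` from `d`. -/
theorem sumNorm_swap_le (hp : p ≠ ∞) (hβ : IsUMDBound p X β) {a b d S : ι → Set ℝ}
    (ha : ∀ i, IsPiece (a i)) (hb : ∀ i, IsPiece (b i)) (hd : ∀ i, IsPiece (d i))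
    (haS : ∀ i, a i ⊆ S i) (hbS : ∀ i, b i ⊆ S i) (hdS : ∀ i, d i ⊆ S i)
    (hab : ∀ i, Disjoint (a i) (b i)) (had : ∀ i, Disjoint (a i) (d i))
    (hbd : ∀ i, Disjoint (b i) (d i))
    (hvb : ∀ i, volume.real (b i) = volume.real (a i))
    (hvd : ∀ i, volume.real (d i) = volume.real (a i)) {rank : ι → ℤ}
    (ha' : ConstOnFiner rank S (ind a)) (hb' : ConstOnFiner rank S (ind b))
    (hd' : ConstOnFiner rank S (ind d)) (x : ι → X) :
    sumNorm p x (ind a - ind d) ≤ β * sumNorm p x (ind a - ind b) := by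
  set A : ι → ℝ → ℝ := ind a - (2⁻¹ : ℝ) • (ind b + ind d) with hA
  set B : ι → ℝ → ℝ := (2⁻¹ : ℝ) • (ind d - ind b) with hB
  have e1 : A + B = ind a - ind b := by rw [hA, hB]; module
  have e2 : A - B = ind a - ind d := by rw [hA, hB]; module
  rw [← e1, ← e2]
  refine sumNorm_sub_le_sumNorm_add hp hβ (S := S) (rank := rank) (fun i => ?_) (fun i => ?_)
    (fun i => ?_) (fun i => ?_) (fun i => ?_) ?_ ?_ x
  · refine ⟨(ha i).isBddFun.sub (((hb i).isBddFun.add (hd i).isBddFun).const_smul _), ?_⟩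
    change ∫ t, ((a i).indicator 1 - (2⁻¹ : ℝ) • ((b i).indicator 1 + (d i).indicator 1) : ℝ → ℝ) t = 0
    rw [(ha i).isBddFun.integral_sub (((hb i).isBddFun.add (hd i).isBddFun).const_smul _),
      IsBddFun.integral_const_smul, (hb i).isBddFun.integral_add (hd i).isBddFun, (ha i).integral,
      (hb i).integral, (hd i).integral, hvb, hvd]
    ring
  · refine ⟨((hd i).isBddFun.sub (hb i).isBddFun).const_smul _, ?_⟩
    change ∫ t, ((2⁻¹ : ℝ) • ((d i).indicator 1 - (b i).indicator 1) : ℝ → ℝ) t = 0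
    rw [IsBddFun.integral_const_smul, (hd i).isBddFun.integral_sub (hb i).isBddFun,
      (hb i).integral, (hd i).integral, hvb, hvd, sub_self, mul_zero]
  · refine Function.support_subset_iff'.2 fun t ht => ?_
    have h1 : t ∉ a i := fun h => ht (haS i h)
    have h2 : t ∉ b i := fun h => ht (hbS i h)
    have h3 : t ∉ d i := fun h => ht (hdS i h)
    simp [hA, ind, h1, h2, h3]
  · refine Function.support_subset_iff'.2 fun t ht => ?_
    have h2 : t ∉ b i := fun h => ht (hbS i h)
    have h3 : t ∉ d i := fun h => ht (hdS i h)
    simp [hB, ind, h2, h3]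
  · have : ∀ t, B i t ≠ 0 → A i t = -2⁻¹ := by
      intro t ht
      by_cases h1 : t ∈ b i
      · have h2 := disjoint_left.1 (hbd i) h1
        have h3 := disjoint_right.1 (hab i) h1
        simp [hA, ind, h1, h2, h3]
      · by_cases h2 : t ∈ d i
        · have h3 := disjoint_right.1 (had i) h2
          simp [hA, ind, h1, h2, h3]
        · simp [hB, ind, h1, h2] at ht
    exact fun s hs t ht => (this s hs).trans (this t ht).symm
  · exact ha'.sub ((hb'.add hd').const_smul _)
  · exact (hd'.sub hb').const_smul _

/-- From `1_a - 1_b` to the distribution of the mass of `M • 1_a` over `P \ (a ∪ b)`, where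
`M + 2` is the quotient of the measures of `P` and `a`. -/
theorem sumNorm_spread_le (hp1 : 1 ≤ p) (hp : p ≠ ∞) (hβ : IsUMDBound p X β) (hβ1 : 1 ≤ β)
    {a b P : ι → Set ℝ} (ha : ∀ i, IsPiece (a i)) (hb : ∀ i, IsPiece (b i))
    (hP : ∀ i, IsPiece (P i)) (haP : ∀ i, a i ⊆ P i) (hbP : ∀ i, b i ⊆ P i)
    (hab : ∀ i, Disjoint (a i) (b i)) {M : ℕ}
    (hvb : ∀ i, volume.real (b i) = volume.real (a i))
    (hvP : ∀ i, volume.real (P i) = (M + 2) * volume.real (a i)) {rank : ι → ℤ}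
    (ha' : ConstOnFiner rank P (ind a)) (hb' : ConstOnFiner rank P (ind b))
    (hP' : ConstOnFiner rank P (ind P)) (x : ι → X) :
    sumNorm p x ((M : ℝ) • ind a - (ind P - ind a - ind b))
      ≤ (M + 1) * (β * sumNorm p x (ind a - ind b)) := by
  have hM : (M : ℝ) + 1 ≠ 0 := by positivity
  set A : ι → ℝ → ℝ := ind a - ((M : ℝ) + 1)⁻¹ • (ind P - ind a) with hA
  set B : ι → ℝ → ℝ := ((M : ℝ) + 1)⁻¹ • (ind P - ind a) - ind b with hB
  have e1 : A + B = ind a - ind b := by rw [hA, hB]; abel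
  have e2 : (M : ℝ) • ind a - (ind P - ind a - ind b) = (M : ℝ) • A - B := by
    funext i t
    simp only [hA, hB, Pi.sub_apply, Pi.smul_apply, smul_eq_mul]
    field_simp
    ring
  have hAi : ∀ i, IsBddFun (A i) := fun i =>
    (ha i).isBddFun.sub (((hP i).isBddFun.sub (ha i).isBddFun).const_smul _)
  have hBi : ∀ i, IsBddFun (B i) := fun i =>
    (((hP i).isBddFun.sub (ha i).isBddFun).const_smul _).sub (hb i).isBddFun
  have hAb : ∀ i, IsBlock (A i) := fun i => by
    refine ⟨hAi i, ?_⟩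
    change ∫ t, ((a i).indicator 1
      - ((M : ℝ) + 1)⁻¹ • ((P i).indicator 1 - (a i).indicator 1) : ℝ → ℝ) t = 0
    rw [(ha i).isBddFun.integral_sub (((hP i).isBddFun.sub (ha i).isBddFun).const_smul _),
      IsBddFun.integral_const_smul, (hP i).isBddFun.integral_sub (ha i).isBddFun,
      (ha i).integral, (hP i).integral, hvP]
    field_simp
    ring
  have hBb : ∀ i, IsBlock (B i) := fun i => by
    refine ⟨hBi i, ?_⟩
    change ∫ t, (((M : ℝ) + 1)⁻¹ • ((P i).indicator 1 - (a i).indicator 1)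
      - (b i).indicator 1 : ℝ → ℝ) t = 0
    rw [(((hP i).isBddFun.sub (ha i).isBddFun).const_smul _).integral_sub (hb i).isBddFun,
      IsBddFun.integral_const_smul, (hP i).isBddFun.integral_sub (ha i).isBddFun,
      (ha i).integral, (hP i).integral, (hb i).integral, hvP, hvb]
    field_simp
    ring
  have hAS : ∀ i, Function.support (A i) ⊆ P i := fun i => by
    refine Function.support_subset_iff'.2 fun t ht => ?_
    have h1 : t ∉ a i := fun h => ht (haP i h)
    simp [hA, ind, h1, ht]
  have hBS : ∀ i, Function.support (B i) ⊆ P i := fun i => by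
    refine Function.support_subset_iff'.2 fun t ht => ?_
    have h1 : t ∉ a i := fun h => ht (haP i h)
    have h2 : t ∉ b i := fun h => ht (hbP i h)
    simp [hB, ind, h1, h2, ht]
  have hAB : ∀ i, ConstOn (A i) (Function.support (B i)) := fun i => by
    have : ∀ t, B i t ≠ 0 → A i t = -((M : ℝ) + 1)⁻¹ := by
      intro t ht
      have h1 : t ∈ P i := hBS i ht
      have h2 : t ∉ a i := fun h2 => by
        have h3 := disjoint_left.1 (hab i) h2
        simp [hB, ind, h1, h2, h3] at ht
      simp [hA, ind, h1, h2]
    exact fun s hs t ht => (this s hs).trans (this t ht).symm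
  have hA' : ConstOnFiner rank P A := ha'.sub ((hP'.sub ha').const_smul _)
  have hB' : ConstOnFiner rank P B := ((hP'.sub ha').const_smul _).sub hb'
  have k1 := sumNorm_left_le_sumNorm_add hp1 hp hβ hβ1 hAb hBb hAS hBS hAB hA' hB' x
  have k2 := sumNorm_right_le_sumNorm_add hp1 hp hβ hβ1 hAb hBb hAS hBS hAB hA' hB' x
  rw [e1] at k1 k2
  rw [e2]
  have hm : ∀ i, Measurable (((M : ℝ) • A) i) := fun i => ((hAi i).const_smul (M : ℝ)).measurable
  refine (sumNorm_sub_le hp1 x hm fun i => (hBi i).measurable).trans ?_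
  rw [sumNorm_const_smul, add_mul, one_mul]
  have : ‖(M : ℝ)‖ₑ = M := by simp
  rw [this]
  gcongr

/-- A function `h i` taking the values `1` on `a i` and `-1` on `b i` dominates `1_a - 1_b`. -/
theorem sumNorm_restrict_le (hp1 : 1 ≤ p) (hp : p ≠ ∞) (hβ : IsUMDBound p X β) (hβ1 : 1 ≤ β)
    {a b P : ι → Set ℝ} {h : ι → ℝ → ℝ} (ha : ∀ i, IsPiece (a i)) (hb : ∀ i, IsPiece (b i))
    (hh : ∀ i, IsBlock (h i)) (hhP : ∀ i, Function.support (h i) ⊆ P i)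
    (hab : ∀ i, Disjoint (a i) (b i))
    (h1 : ∀ i, ∀ t ∈ a i, h i t = 1) (h2 : ∀ i, ∀ t ∈ b i, h i t = -1)
    (hvb : ∀ i, volume.real (b i) = volume.real (a i)) {rank : ι → ℤ}
    (ha' : ConstOnFiner rank P (ind a)) (hb' : ConstOnFiner rank P (ind b))
    (hh' : ConstOnFiner rank P h) (x : ι → X) :
    sumNorm p x (ind a - ind b) ≤ β * sumNorm p x h := by
  have hA : ∀ i, IsBlock ((ind a - ind b) i) := fun i => by
    refine ⟨(ha i).isBddFun.sub (hb i).isBddFun, ?_⟩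
    change ∫ t, ((a i).indicator 1 - (b i).indicator 1 : ℝ → ℝ) t = 0
    rw [(ha i).isBddFun.integral_sub (hb i).isBddFun,
      (hb i).integral, (ha i).integral, hvb, sub_self]
  have hB : ∀ i, IsBlock ((h - (ind a - ind b)) i) := fun i => by
    refine ⟨(hh i).toIsBddFun.sub (hA i).toIsBddFun, ?_⟩
    have := (hh i).toIsBddFun.integral_sub (hA i).toIsBddFun
    rw [(hh i).integral_eq_zero, (hA i).integral_eq_zero, sub_zero] at this
    exact this
  have h0 : ∀ i t, t ∉ P i → h i t = 0 := fun i => Function.support_subset_iff'.1 (hhP i)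
  have haP : ∀ i t, t ∉ P i → t ∉ a i := fun i t ht ha => by
    have := h1 i t ha
    rw [h0 i t ht] at this
    norm_num at this
  have hbP : ∀ i t, t ∉ P i → t ∉ b i := fun i t ht hb => by
    have := h2 i t hb
    rw [h0 i t ht] at this
    norm_num at this
  have key := sumNorm_left_le_sumNorm_add hp1 hp hβ hβ1 hA hB (S := P) (rank := rank)
    (fun i => Function.support_subset_iff'.2 fun t ht => ?_)
    (fun i => Function.support_subset_iff'.2 fun t ht => ?_) (fun i => ?_) (ha'.sub hb')
    (hh'.sub (ha'.sub hb')) x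
  · rwa [add_sub_cancel] at key
  · simp [ind, haP i t ht, hbP i t ht]
  · simp [ind, haP i t ht, hbP i t ht, h0 i t ht]
  · have : ∀ t, (h - (ind a - ind b)) i t ≠ 0 → (ind a - ind b) i t = 0 := by
      intro t ht
      by_cases hta : t ∈ a i
      · have := disjoint_left.1 (hab i) hta
        simp [ind, hta, this, h1 i t hta] at ht
      · by_cases htb : t ∈ b i
        · simp [ind, hta, htb, h2 i t htb] at ht
        · simp [ind, hta, htb]
    exact fun s hs t ht => (this s hs).trans (this t ht).symm

/-- The passage from `1_a - 1_b`, with `a, b ⊆ P`, to `1_{P'} - 1_P`, where `a', b' ⊆ P'` have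
the measure of `a, b`. Only the four sets `a, b, a', b'` have to respect the finer sets `P ∪ P'`. -/
theorem sumNorm_shift_le (hp1 : 1 ≤ p) (hp : p ≠ ∞) (hβ : IsUMDBound p X β) (hβ1 : 1 ≤ β)
    {a b P a' b' P' : ι → Set ℝ} (ha : ∀ i, IsPiece (a i)) (hb : ∀ i, IsPiece (b i))
    (hP : ∀ i, IsPiece (P i)) (ha₂ : ∀ i, IsPiece (a' i)) (hb₂ : ∀ i, IsPiece (b' i))
    (hP₂ : ∀ i, IsPiece (P' i)) (haP : ∀ i, a i ⊆ P i) (hbP : ∀ i, b i ⊆ P i)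
    (haP₂ : ∀ i, a' i ⊆ P' i) (hbP₂ : ∀ i, b' i ⊆ P' i)
    (hab : ∀ i, Disjoint (a i) (b i)) (hab₂ : ∀ i, Disjoint (a' i) (b' i))
    (hPP : ∀ i, Disjoint (P i) (P' i)) {M : ℕ}
    (hvb : ∀ i, volume.real (b i) = volume.real (a i))
    (hva₂ : ∀ i, volume.real (a' i) = volume.real (a i))
    (hvb₂ : ∀ i, volume.real (b' i) = volume.real (a i))
    (hvP : ∀ i, volume.real (P i) = (M + 2) * volume.real (a i))
    (hvP₂ : ∀ i, volume.real (P' i) = (M + 2) * volume.real (a i)) {rank : ι → ℤ}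
    (hac : ConstOnFiner rank (fun i => P i ∪ P' i) (ind a))
    (hbc : ConstOnFiner rank (fun i => P i ∪ P' i) (ind b))
    (hac₂ : ConstOnFiner rank (fun i => P i ∪ P' i) (ind a'))
    (hbc₂ : ConstOnFiner rank (fun i => P i ∪ P' i) (ind b'))
    (hPc : ConstOnFiner rank P (ind P)) (hPc₂ : ConstOnFiner rank P' (ind P')) (x : ι → X) :
    sumNorm p x (ind P' - ind P) ≤ (3 * M + 4) * β ^ 3 * sumNorm p x (ind a - ind b) := by
  have hl : ∀ i, P i ⊆ P i ∪ P' i := fun i => subset_union_left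
  have hr : ∀ i, P' i ⊆ P i ∪ P' i := fun i => subset_union_right
  set F := sumNorm p x (ind a - ind b) with hF
  have sub_comm' : ∀ u v : ι → ℝ → ℝ, sumNorm p x (u - v) = sumNorm p x (v - u) := fun u v => by
    rw [← sumNorm_neg, neg_sub]
  have hbβ : β ≤ β ^ 3 := le_self_pow hβ1 (by norm_num)
  -- translate `a`, keeping the reference set `a`
  have t1 : sumNorm p x (ind a - ind a') ≤ β * F :=
    sumNorm_swap_le hp hβ ha hb ha₂ (fun i => (haP i).trans (hl i)) (fun i => (hbP i).trans (hl i))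
      (fun i => (haP₂ i).trans (hr i)) hab (fun i => (hPP i).mono (haP i) (haP₂ i))
      (fun i => (hPP i).mono (hbP i) (haP₂ i)) hvb hva₂ hac hbc hac₂ x
  have t2 : sumNorm p x (ind b - ind b') ≤ β * F := by
    rw [hF, sub_comm' (ind a)]
    exact sumNorm_swap_le hp hβ hb ha hb₂ (fun i => (hbP i).trans (hl i))
      (fun i => (haP i).trans (hl i)) (fun i => (hbP₂ i).trans (hr i)) (fun i => (hab i).symm)
      (fun i => (hPP i).mono (hbP i) (hbP₂ i)) (fun i => (hPP i).mono (haP i) (hbP₂ i))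
      (fun i => (hvb i).symm) (fun i => (hvb₂ i).trans (hvb i).symm) hbc hac hbc₂ x
  -- spread the mass of `a` over the rest of `P`
  have t3 := sumNorm_spread_le hp1 hp hβ hβ1 ha hb hP haP hbP hab hvb hvP (hac.mono hl)
    (hbc.mono hl) hPc x
  -- `1_{a'} - 1_{b'}` is reached by way of `1_a - 1_{a'}`
  have t4 : sumNorm p x (ind a' - ind b') ≤ β * (β * F) := by
    refine (sumNorm_swap_le hp hβ ha₂ ha hb₂ (fun i => (haP₂ i).trans (hr i))
      (fun i => (haP i).trans (hl i)) (fun i => (hbP₂ i).trans (hr i))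
      (fun i => ((hPP i).mono (haP i) (haP₂ i)).symm) hab₂
      (fun i => (hPP i).mono (haP i) (hbP₂ i)) (fun i => (hva₂ i).symm)
      (fun i => (hvb₂ i).trans (hva₂ i).symm) hac₂ hac hbc₂ x).trans ?_
    rw [sub_comm' (ind a')]
    gcongr
  -- spread the mass of `a'` over the rest of `P'`
  have t5 := sumNorm_spread_le hp1 hp hβ hβ1 ha₂ hb₂ hP₂ haP₂ hbP₂ hab₂
    (fun i => (hvb₂ i).trans (hva₂ i).symm) (fun i => by rw [hvP₂, hva₂]) (hac₂.mono hr)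
    (hbc₂.mono hr) hPc₂ x
  have hM : ‖(M : ℝ)‖ₑ = M := by simp
  have ma := fun i => (ha i).isBddFun.measurable
  have mb := fun i => (hb i).isBddFun.measurable
  have mP := fun i => (hP i).isBddFun.measurable
  have ma₂ := fun i => (ha₂ i).isBddFun.measurable
  have mb₂ := fun i => (hb₂ i).isBddFun.measurable
  have mP₂ := fun i => (hP₂ i).isBddFun.measurable
  set u₁ : ι → ℝ → ℝ := ind a - ind a'
  set u₂ : ι → ℝ → ℝ := ind b - ind b'
  set u₃ : ι → ℝ → ℝ := (M : ℝ) • ind a - (ind P - ind a - ind b) with hu₃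
  set u₅ : ι → ℝ → ℝ := (M : ℝ) • ind a' - (ind P' - ind a' - ind b') with hu₅
  have m1 : ∀ i, Measurable (u₁ i) := fun i => (ma i).sub (ma₂ i)
  have m2 : ∀ i, Measurable (u₂ i) := fun i => (mb i).sub (mb₂ i)
  have m3 : ∀ i, Measurable (u₃ i) := fun i =>
    ((ma i).const_smul (M : ℝ)).sub (((mP i).sub (ma i)).sub (mb i))
  have m5 : ∀ i, Measurable (u₅ i) := fun i =>
    ((ma₂ i).const_smul (M : ℝ)).sub (((mP₂ i).sub (ma₂ i)).sub (mb₂ i))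
  -- `P` is `a ∪ b` and a remainder of mass `M` times that of `a`
  have e : ind P' - ind P = u₃ - u₅ - (M : ℝ) • u₁ - u₁ - u₂ := by
    simp only [u₁, u₂, hu₃, hu₅]; module
  have hm1 : ∀ i, Measurable (((M : ℝ) • u₁) i) := fun i => (m1 i).const_smul (M : ℝ)
  rw [e]
  calc sumNorm p x (u₃ - u₅ - (M : ℝ) • u₁ - u₁ - u₂)
      ≤ sumNorm p x u₃ + sumNorm p x u₅ + sumNorm p x ((M : ℝ) • u₁) + sumNorm p x u₁
          + sumNorm p x u₂ := by
        refine (sumNorm_sub_le hp1 x (fun i => ?_) m2).trans (add_le_add_left ?_ _)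
        · exact (((m3 i).sub (m5 i)).sub (hm1 i)).sub (m1 i)
        refine (sumNorm_sub_le hp1 x (fun i => ?_) m1).trans (add_le_add_left ?_ _)
        · exact ((m3 i).sub (m5 i)).sub (hm1 i)
        refine (sumNorm_sub_le hp1 x (fun i => ?_) hm1).trans (add_le_add_left ?_ _)
        · exact (m3 i).sub (m5 i)
        exact sumNorm_sub_le hp1 x m3 m5
    _ ≤ (M + 1) * (β * F) + (M + 1) * (β * (β * (β * F))) + M * (β * F) + β * F + β * F := by
        rw [sumNorm_const_smul, hM]
        gcongr
        exact t5.trans (by gcongr)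
    _ ≤ (M + 1) * (β ^ 3 * F) + (M + 1) * (β * (β * (β * F))) + M * (β ^ 3 * F) + β ^ 3 * F
          + β ^ 3 * F := by gcongr
    _ = (3 * M + 4) * β ^ 3 * F := by ring

end Families

/-! ### Dyadic intervals and the shift estimate for compatible collections -/

/-- The point `u` does not separate points of `S`. -/
def NotSep (u : ℝ) (S : Set ℝ) : Prop := (∀ t ∈ S, u ≤ t) ∨ ∀ t ∈ S, t < u

theorem constOn_indicator_Ico {u v : ℝ} {S : Set ℝ} (hu : NotSep u S) (hv : NotSep v S) :
    ConstOn ((Ico u v).indicator 1) S := by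
  intro s hs t ht
  have h1 : u ≤ s ↔ u ≤ t := by
    rcases hu with h | h
    · exact iff_of_true (h s hs) (h t ht)
    · exact iff_of_false (h s hs).not_ge (h t ht).not_ge
  have h2 : s < v ↔ t < v := by
    rcases hv with h | h
    · exact iff_of_false (h s hs).not_gt (h t ht).not_gt
    · exact iff_of_true (h s hs) (h t ht)
  simp only [indicator, mem_Ico, h1, h2, Pi.one_apply]

theorem constOn_of_disjoint_support {f : ℝ → ℝ} {S : Set ℝ} (h : ∀ t ∈ S, f t = 0) : ConstOn f S :=
  fun s hs t ht => (h s hs).trans (h t ht).symm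

/-- Passage from the integers to the real line: the point `2^{-i} (P + n / N)` does not separate
the points of `[2^{-j} q, 2^{-j} r)`, where `j = i + e`. -/
theorem notSep_of_int {i j P q r : ℤ} {e N n : ℕ} (hN : 0 < N) (hij : j = i + e) {S : Set ℝ}
    (hS : ∀ t ∈ S, (2 : ℝ) ^ (-j) * q ≤ t ∧ t < (2 : ℝ) ^ (-j) * r)
    (h : 2 ^ e * (N * P + n) ≤ N * q ∨ N * r ≤ 2 ^ e * (N * P + n)) :
    NotSep ((2 : ℝ) ^ (-i) * (P + n / N)) S := by
  have hc : (0 : ℝ) < (2 : ℝ) ^ (-j) := by positivity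
  have hN' : (0 : ℝ) < N := by exact_mod_cast hN
  have e1 : (2 : ℝ) ^ (-i) = (2 : ℝ) ^ (-j) * 2 ^ e := by
    rw [← zpow_natCast, ← zpow_add₀ (by norm_num)]
    congr 1; omega
  have e2 : (2 : ℝ) ^ (-i) * (P + n / N) = (2 : ℝ) ^ (-j) * (2 ^ e * (N * P + n) / N) := by
    rw [e1]; field_simp
  rw [e2]
  rcases h with h | h
  · refine Or.inl fun t ht => le_trans ?_ (hS t ht).1
    refine mul_le_mul_of_nonneg_left ?_ hc.le
    rw [div_le_iff₀ hN', mul_comm (q : ℝ)]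
    exact_mod_cast h
  · refine Or.inr fun t ht => (hS t ht).2.trans_le ?_
    refine mul_le_mul_of_nonneg_left ?_ hc.le
    rw [le_div_iff₀ hN', mul_comm (r : ℝ)]
    exact_mod_cast h

/-- The `n`-th of `N` consecutive subintervals of equal length of `I`. -/
def subPiece (N n : ℕ) (I : DyadicInterval) : Set ℝ :=
  Ico ((2 : ℝ) ^ (-I.scale) * (I.pos + n / N)) ((2 : ℝ) ^ (-I.scale) * (I.pos + (n + 1 : ℕ) / N))

theorem isPiece_Ico (u v : ℝ) : IsPiece (Ico u v) :=
  ⟨measurableSet_Ico, max |u| |v|, fun _ ht => abs_le_max_abs_abs ht.1 ht.2.le⟩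

theorem volume_subPiece (N n : ℕ) (I : DyadicInterval) :
    volume.real (subPiece N n I) = I.length / N := by
  have h := I.length_pos
  have e : (2 : ℝ) ^ (-I.scale) * (I.pos + (n + 1 : ℕ) / N)
      - (2 : ℝ) ^ (-I.scale) * (I.pos + n / N) = I.length / N := by
    simp only [length]; push_cast; ring
  rw [subPiece, Measure.real, Real.volume_Ico, e, ENNReal.toReal_ofReal (by positivity)]

theorem subPiece_subset {N n : ℕ} (hn : n + 1 ≤ N) (I : DyadicInterval) :
    subPiece N n I ⊆ I.toSet := by
  have h : (0 : ℝ) < (2 : ℝ) ^ (-I.scale) := by positivity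
  have hN : (0 : ℝ) < N := by exact_mod_cast (by omega : 0 < N)
  refine Ico_subset_Ico ?_ ?_ <;> refine mul_le_mul_of_nonneg_left ?_ h.le
  · exact le_add_of_nonneg_right (by positivity)
  · gcongr
    rw [div_le_one hN]
    exact_mod_cast hn

theorem disjoint_subPiece {N α γ : ℕ} (h : α + 1 ≤ γ) (I : DyadicInterval) :
    Disjoint (subPiece N α I) (subPiece N γ I) := by
  refine disjoint_left.2 fun t h1 h2 => (h1.2.trans_le ?_).not_ge h2.1
  gcongr

theorem haar_of_mem_subPiece_left {N n : ℕ} (hn : 2 * (n + 1) ≤ N) (I : DyadicInterval) {t : ℝ}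
    (ht : t ∈ subPiece N n I) : I.haar t = 1 := by
  have hN : (0 : ℝ) < N := by exact_mod_cast (by omega : 0 < N)
  have h : (0 : ℝ) < (2 : ℝ) ^ (-I.scale) := by positivity
  have h1 : ((n + 1 : ℕ) : ℝ) / N ≤ 1 / 2 := by
    rw [div_le_div_iff₀ hN (by norm_num), one_mul, mul_comm]
    exact_mod_cast hn
  have h2 : (0 : ℝ) ≤ n / N := by positivity
  have h3 := mul_le_mul_of_nonneg_left h1 h.le
  have h4 := mul_nonneg h.le h2
  obtain ⟨ht1, ht2⟩ := ht
  rw [mul_add] at ht1 ht2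
  have m1 : t ∈ Ico I.left (I.left + I.length / 2) := by
    simp only [left, length, mem_Ico]; constructor <;> linarith
  have m2 : t ∉ Ico (I.left + I.length / 2) (I.left + I.length) := fun hh => by
    linarith [m1.2, hh.1]
  rw [haar_eq]
  simp [indicator_of_mem m1, indicator_of_notMem m2]

theorem haar_of_mem_subPiece_right {N n : ℕ} (hn : N ≤ 2 * n) (hn' : n + 1 ≤ N)
    (I : DyadicInterval) {t : ℝ} (ht : t ∈ subPiece N n I) : I.haar t = -1 := by
  have hN : (0 : ℝ) < N := by exact_mod_cast (by omega : 0 < N)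
  have h : (0 : ℝ) < (2 : ℝ) ^ (-I.scale) := by positivity
  have h1 : (1 : ℝ) / 2 ≤ n / N := by
    rw [div_le_div_iff₀ (by norm_num) hN, one_mul, mul_comm]
    exact_mod_cast hn
  have h2 : ((n + 1 : ℕ) : ℝ) / N ≤ 1 := by
    rw [div_le_one hN]
    exact_mod_cast hn'
  have h3 := mul_le_mul_of_nonneg_left h1 h.le
  have h4 := mul_le_mul_of_nonneg_left h2 h.le
  obtain ⟨ht1, ht2⟩ := ht
  rw [mul_add] at ht1 ht2
  have m1 : t ∈ Ico (I.left + I.length / 2) (I.left + I.length) := by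
    simp only [left, length, mem_Ico]; constructor <;> linarith
  have m2 : t ∉ Ico I.left (I.left + I.length / 2) := fun hh => by
    linarith [m1.1, hh.2]
  rw [haar_eq]
  simp [indicator_of_mem m1, indicator_of_notMem m2]

theorem support_haar_subset (I : DyadicInterval) : Function.support I.haar ⊆ I.toSet := by
  have h := I.length_pos
  refine Function.support_subset_iff'.2 fun t ht => ?_
  have e : I.toSet = Ico I.left (I.left + I.length) := by
    simp only [toSet, left, length]; congr 1; ring
  rw [e, mem_Ico, not_and_or, not_le, not_lt] at ht
  have m1 : t ∉ Ico I.left (I.left + I.length / 2) := fun hh => by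
    rcases ht with ht | ht <;> linarith [hh.1, hh.2]
  have m2 : t ∉ Ico (I.left + I.length / 2) (I.left + I.length) := fun hh => by
    rcases ht with ht | ht <;> linarith [hh.1, hh.2]
  rw [haar_eq]
  simp [indicator_of_notMem m1, indicator_of_notMem m2]

theorem isBlock_haar (I : DyadicInterval) : IsBlock I.haar := by
  refine ⟨?_, integral_haar I⟩
  rw [haar_eq]
  exact (isPiece_Ico _ _).isBddFun.sub (isPiece_Ico _ _).isBddFun

theorem constOn_haar {I J : DyadicInterval} (h : I.scale < J.scale) : ConstOn I.haar J.toSet := by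
  obtain ⟨e, he⟩ := Int.eq_ofNat_of_zero_le (by omega : 0 ≤ J.scale - I.scale - 1)
  -- the endpoints and the midpoint of `I` do not cut `J`
  have key : ∀ n : ℕ, NotSep ((2 : ℝ) ^ (-I.scale) * (I.pos + n / (2 : ℕ))) J.toSet := by
    intro n
    refine notSep_of_int (j := J.scale) (q := J.pos) (r := J.pos + 1) (e := e + 1) (by norm_num)
      (by push_cast; omega) (fun t ht => by simpa [toSet] using ht) ?_
    rw [pow_succ]
    push_cast
    have : (2 : ℤ) ^ e * 2 * (2 * I.pos + n) = 2 * (2 ^ e * (2 * I.pos + n)) := by ring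
    rw [this]
    omega
  have k0 := key 0
  have k1 := key 1
  have k2 := key 2
  rw [haar_eq]
  refine ConstOn.sub (f := (Ico _ _).indicator 1) (g := (Ico _ _).indicator 1)
    (constOn_indicator_Ico ?_ ?_) (constOn_indicator_Ico ?_ ?_)
  · convert k0 using 1; simp [left]
  · convert k1 using 1; simp only [left, length]; push_cast; ring
  · convert k1 using 1; simp only [left, length]; push_cast; ring
  · convert k2 using 1; simp only [left, length]; push_cast; ring

theorem constOn_toSet {I J : DyadicInterval} (hs : I.scale < J.scale) :
    ConstOn (I.toSet.indicator 1) J.toSet := by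
  obtain ⟨e, he⟩ := Int.eq_ofNat_of_zero_le (by omega : 0 ≤ J.scale - I.scale)
  have key : ∀ n : ℕ, NotSep ((2 : ℝ) ^ (-I.scale) * (I.pos + n / (1 : ℕ))) J.toSet := by
    intro n
    refine notSep_of_int (j := J.scale) (q := J.pos) (r := J.pos + 1) (e := e) (by norm_num)
      (by omega) (fun t ht => by simpa [toSet] using ht) ?_
    push_cast
    omega
  have k0 := key 0
  have k1 := key 1
  refine constOn_indicator_Ico ?_ ?_
  · convert k0 using 1; simp
  · convert k1 using 1; simp

theorem disjoint_toSet {I J : DyadicInterval} (h : I.scale = J.scale) (hne : I.pos ≠ J.pos) :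
    Disjoint I.toSet J.toSet := by
  have hc : (0 : ℝ) < (2 : ℝ) ^ (-J.scale) := by positivity
  refine disjoint_left.2 fun t h1 h2 => ?_
  simp only [toSet, mem_Ico, h] at h1 h2
  have a1 := lt_of_mul_lt_mul_left (h1.1.trans_lt h2.2) hc.le
  have a2 := lt_of_mul_lt_mul_left (h2.1.trans_lt h1.2) hc.le
  have b1 : I.pos < J.pos + 1 := by exact_mod_cast a1
  have b2 : J.pos < I.pos + 1 := by exact_mod_cast a2
  omega

/-- The unions `I ∪ τ_m(I)`, `I ∈ 𝓒`, of the same size are disjoint, and no such union is cut by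
the endpoints of the subintervals number `α` and `γ` (out of `N`) of a larger interval `I` or
`τ_m(I)`, `I ∈ 𝓒`. The statements are about integers: positions are compared in the units of the
smaller interval. -/
structure IsShiftCompatible (m N α γ : ℕ) (𝓒 : Set DyadicInterval) : Prop where
  pos_ne : ∀ I ∈ 𝓒, ∀ J ∈ 𝓒, I.scale = J.scale → I.pos + m ≠ J.pos
  endpoints : ∀ I ∈ 𝓒, ∀ J ∈ 𝓒, I.scale < J.scale → ∃ e : ℕ, J.scale = I.scale + e ∧
    ∀ P : ℤ, (P = I.pos ∨ P = I.pos + m) → ∀ n : ℕ, (n = α ∨ n = α + 1 ∨ n = γ ∨ n = γ + 1) →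
      2 ^ e * (N * P + n) ≤ N * J.pos ∨ N * (J.pos + m + 1) ≤ 2 ^ e * (N * P + n)

namespace IsShiftCompatible

variable {m M α γ : ℕ} {𝓒 : Set DyadicInterval}

theorem disjoint_union {N : ℕ} (h : IsShiftCompatible m N α γ 𝓒) {I J : DyadicInterval} (hI : I ∈ 𝓒)
    (hJ : J ∈ 𝓒) (hs : I.scale = J.scale) (hne : I ≠ J) :
    Disjoint (I.toSet ∪ (I.shift m).toSet) (J.toSet ∪ (J.shift m).toSet) := by
  have h0 : I.pos ≠ J.pos := fun h' => hne (DyadicInterval.ext hs h')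
  have h1 := h.pos_ne I hI J hJ hs
  have h2 := h.pos_ne J hJ I hI hs.symm
  simp only [disjoint_union_left, disjoint_union_right]
  refine ⟨⟨disjoint_toSet hs h0, disjoint_toSet hs ?_⟩, disjoint_toSet hs ?_, disjoint_toSet hs ?_⟩
  all_goals simp only [shift]; omega

theorem constOn_of_scale_eq {N : ℕ} (h : IsShiftCompatible m N α γ 𝓒) {I J : DyadicInterval}
    (hI : I ∈ 𝓒) (hJ : J ∈ 𝓒) (hs : I.scale = J.scale) (hne : I ≠ J) {S : Set ℝ}
    (hS : S ⊆ I.toSet ∪ (I.shift m).toSet) :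
    ConstOn (S.indicator 1) (J.toSet ∪ (J.shift m).toSet) :=
  constOn_of_disjoint_support fun _ ht => indicator_of_notMem
    (fun hh => disjoint_left.1 (h.disjoint_union hI hJ hs hne) (hS hh) ht) _

theorem constOn_subPiece {N : ℕ} (hN : 0 < N) (h : IsShiftCompatible m N α γ 𝓒)
    {I J : DyadicInterval} (hI : I ∈ 𝓒) (hJ : J ∈ 𝓒) (hs : I.scale < J.scale)
    {I' : DyadicInterval} (hI' : I' = I ∨ I' = I.shift m) {n : ℕ} (hn : n = α ∨ n = γ) :
    ConstOn ((subPiece N n I').indicator 1) (J.toSet ∪ (J.shift m).toSet) := by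
  obtain ⟨e, he, hk⟩ := h.endpoints I hI J hJ hs
  have h1 : I'.scale = I.scale := by rcases hI' with rfl | rfl <;> rfl
  have h2 : I'.pos = I.pos ∨ I'.pos = I.pos + m := by
    rcases hI' with rfl | rfl
    · exact Or.inl rfl
    · exact Or.inr rfl
  have hc : (0 : ℝ) < (2 : ℝ) ^ (-J.scale) := by positivity
  have hS : ∀ t ∈ J.toSet ∪ (J.shift m).toSet, (2 : ℝ) ^ (-J.scale) * J.pos ≤ t ∧
      t < (2 : ℝ) ^ (-J.scale) * (J.pos + m + 1 : ℤ) := by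
    have hm : 0 ≤ (2 : ℝ) ^ (-J.scale) * m := by positivity
    rintro t (ht | ht) <;> simp only [toSet, shift, mem_Ico] at ht <;> push_cast at ht ⊢ <;>
      constructor <;> nlinarith
  refine constOn_indicator_Ico ?_ ?_
  · exact notSep_of_int hN (h1 ▸ he) hS (hk _ h2 n (by tauto))
  · exact notSep_of_int hN (h1 ▸ he) hS (hk _ h2 (n + 1) (by omega))

variable {X : Type*} [NormedAddCommGroup X] [NormedSpace ℝ X] [CompleteSpace X] {p β : ℝ≥0∞}

/-- The shift estimate for finitely many intervals of a compatible collection. -/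
theorem sumNorm_rearrangedHaar_le (h : IsShiftCompatible m (M + 2) α γ 𝓒) (hm : 1 ≤ m)
    (hα : 2 * (α + 1) ≤ M + 2) (hγ : M + 2 ≤ 2 * γ) (hγ' : γ + 1 ≤ M + 2)
    (hp1 : 1 ≤ p) (hp : p ≠ ∞) (hβ : IsUMDBound p X β) (hβ1 : 1 ≤ β)
    (F : Finset DyadicInterval) (hF : ∀ I ∈ F, I ∈ 𝓒) (x : F → X) :
    sumNorm p x (fun I : F => rearrangedHaar m I)
      ≤ (3 * M + 4) * β ^ 4 * sumNorm p x (fun I : F => haar I) := by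
  have hN : 0 < M + 2 := by omega
  have hN' : (M : ℝ) + 2 ≠ 0 := by positivity
  have hne : ∀ {I J : F}, I ≠ J → (I : DyadicInterval) ≠ J := fun hh h' => hh (Subtype.ext h')
  let rank : F → ℤ := fun I => I.1.scale
  have hcross : ∀ {n : ℕ}, n = α ∨ n = γ → ∀ k : ℤ, (k = 0 ∨ k = m) →
      ConstOnFiner rank (fun I : F => I.1.toSet ∪ (I.1.shift m).toSet)
        (ind fun I : F => subPiece (M + 2) n (I.1.shift k)) := by
    intro n hn k hk I J hIJ hr
    have hnM : n + 1 ≤ M + 2 := by omega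
    have hI' : I.1.shift k = I.1 ∨ I.1.shift k = I.1.shift m := by
      rcases hk with rfl | rfl
      · exact Or.inl (by simp [shift])
      · exact Or.inr rfl
    rcases hr.lt_or_eq with hr | hr
    · exact h.constOn_subPiece hN (hF I I.2) (hF J J.2) hr hI' hn
    · refine h.constOn_of_scale_eq (hF I I.2) (hF J J.2) hr (hne hIJ)
        ((subPiece_subset hnM _).trans ?_)
      rcases hI' with h' | h' <;> rw [h']
      · exact subset_union_left
      · exact subset_union_right
  have hs0 : ∀ I : DyadicInterval, I.shift 0 = I := fun I => by simp [shift]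
  have hac := hcross (Or.inl rfl) 0 (Or.inl rfl)
  have hbc := hcross (Or.inr rfl) 0 (Or.inl rfl)
  have hac₂ := hcross (Or.inl rfl) m (Or.inr rfl)
  have hbc₂ := hcross (Or.inr rfl) m (Or.inr rfl)
  simp only [hs0] at hac hbc
  have hPc : ConstOnFiner rank (fun I : F => I.1.toSet) (ind fun I : F => I.1.toSet) := by
    intro I J hIJ hr
    rcases hr.lt_or_eq with hr | hr
    · exact constOn_toSet hr
    · exact (h.constOn_of_scale_eq (hF I I.2) (hF J J.2) hr (hne hIJ) subset_union_left).mono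
        subset_union_left
  have hPc₂ : ConstOnFiner rank (fun I : F => (I.1.shift m).toSet)
      (ind fun I : F => (I.1.shift m).toSet) := by
    intro I J hIJ hr
    rcases hr.lt_or_eq with hr | hr
    · exact constOn_toSet (I := I.1.shift m) (J := J.1.shift m) hr
    · exact (h.constOn_of_scale_eq (hF I I.2) (hF J J.2) hr (hne hIJ) subset_union_right).mono
        subset_union_right
  have hhc : ConstOnFiner rank (fun I : F => I.1.toSet) (fun I : F => haar I) := by
    intro I J hIJ hr
    rcases hr.lt_or_eq with hr | hr
    · exact constOn_haar hr
    · refine constOn_of_disjoint_support fun t ht => ?_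
      refine Function.support_subset_iff'.1 (support_haar_subset _) t fun hh => ?_
      exact disjoint_left.1 (h.disjoint_union (hF I I.2) (hF J J.2) hr (hne hIJ)) (Or.inl hh)
        (Or.inl ht)
  have hvol : ∀ I : DyadicInterval,
      volume.real I.toSet = (M + 2) * volume.real (subPiece (M + 2) α I) := by
    intro I
    rw [volume_subPiece, Measure.real, volume_toSet, ENNReal.toReal_ofReal I.length_pos.le]
    push_cast
    field_simp
  have hlen : ∀ I : DyadicInterval, (I.shift m).length = I.length := fun I => rfl
  have step1 := sumNorm_shift_le hp1 hp hβ hβ1 (rank := rank) (M := M)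
    (a := fun I : F => subPiece (M + 2) α I.1) (b := fun I : F => subPiece (M + 2) γ I.1)
    (P := fun I : F => I.1.toSet) (a' := fun I : F => subPiece (M + 2) α (I.1.shift m))
    (b' := fun I : F => subPiece (M + 2) γ (I.1.shift m))
    (P' := fun I : F => (I.1.shift m).toSet)
    (fun _ => isPiece_Ico _ _) (fun _ => isPiece_Ico _ _) (fun _ => isPiece_Ico _ _)
    (fun _ => isPiece_Ico _ _) (fun _ => isPiece_Ico _ _) (fun _ => isPiece_Ico _ _)
    (fun _ => subPiece_subset (by omega) _) (fun _ => subPiece_subset hγ' _)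
    (fun _ => subPiece_subset (by omega) _) (fun _ => subPiece_subset hγ' _)
    (fun _ => disjoint_subPiece (by omega) _) (fun _ => disjoint_subPiece (by omega) _)
    (fun I => disjoint_toSet (I := I.1) (J := I.1.shift m) rfl (by simp only [shift]; omega))
    (fun I => by rw [volume_subPiece, volume_subPiece])
    (fun I => by rw [volume_subPiece, volume_subPiece, hlen])
    (fun I => by rw [volume_subPiece, volume_subPiece, hlen])
    (fun I => hvol _) (fun I => by rw [hvol, volume_subPiece, volume_subPiece, hlen])
    hac hbc hac₂ hbc₂ hPc hPc₂ x
  have step2 := sumNorm_restrict_le hp1 hp hβ hβ1 (rank := rank)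
    (a := fun I : F => subPiece (M + 2) α I.1) (b := fun I : F => subPiece (M + 2) γ I.1)
    (P := fun I : F => I.1.toSet) (h := fun I : F => haar I)
    (fun _ => isPiece_Ico _ _) (fun _ => isPiece_Ico _ _) (fun I => isBlock_haar I)
    (fun I => support_haar_subset I) (fun _ => disjoint_subPiece (by omega) _)
    (fun I t ht => haar_of_mem_subPiece_left hα I ht)
    (fun I t ht => haar_of_mem_subPiece_right hγ hγ' I ht)
    (fun I => by rw [volume_subPiece, volume_subPiece])
    (hac.mono fun _ => subset_union_left) (hbc.mono fun _ => subset_union_left) hhc x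
  calc sumNorm p x (fun I : F => rearrangedHaar m I)
      ≤ (3 * M + 4) * β ^ 3 * sumNorm p x (ind (fun I : F => subPiece (M + 2) α I.1)
          - ind fun I : F => subPiece (M + 2) γ I.1) := step1
    _ ≤ (3 * M + 4) * β ^ 3 * (β * sumNorm p x (fun I : F => haar I)) := by gcongr
    _ = (3 * M + 4) * β ^ 4 * sumNorm p x (fun I : F => haar I) := by ring

end IsShiftCompatible

/-! ### The collections of the splitting are compatible -/

/-- `2 ^ λ`, the ratio of the lengths of intervals in consecutive generations of `𝒜_i`, is a
multiple of `16` and larger than `4 m`. -/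
theorem splitGap_bounds {m : ℕ} (hm : 1 ≤ m) :
    4 ≤ splitGap m ∧ (4 * m : ℤ) < 2 ^ splitGap m := by
  rcases hm.eq_or_lt with rfl | hm
  · simp [splitGap]
  · obtain ⟨h1, -, h3⟩ := splitGap_spec m hm
    refine ⟨h1, ?_⟩
    obtain ⟨k, hk⟩ := Nat.exists_eq_add_of_le (by omega : 2 ≤ splitGap m)
    rw [hk] at h3 ⊢
    rw [Nat.add_sub_cancel_left] at h3
    have : (m : ℤ) < 2 ^ k := by exact_mod_cast h3
    rw [pow_add]
    linarith

theorem exists_pos_of_mem_evenColl {m : ℕ} {I : DyadicInterval} (h : I ∈ evenColl m) :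
    ∃ j k : ℤ, j % 2 = 0 ∧ 0 ≤ k ∧ k < m ∧ I.pos = j * m + k := by
  simp only [evenColl, mem_iUnion, mem_ofPred_eq] at h
  obtain ⟨j, hj, J, ⟨I₀, h0, k, hk, rfl⟩, rfl⟩ := h
  refine ⟨j, k, Int.even_iff.1 hj, by omega, by exact_mod_cast hk, ?_⟩
  have : I₀.pos = 0 := by
    have h2 : (2 : ℝ) ^ (-I₀.scale) ≠ 0 := by positivity
    exact_mod_cast (mul_eq_zero.1 h0).resolve_left h2
  simp only [shift, this]
  ring

theorem exists_pos_of_mem_oddColl {m : ℕ} {I : DyadicInterval} (h : I ∈ oddColl m) :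
    ∃ j k : ℤ, j % 2 = 1 ∧ 0 ≤ k ∧ k < m ∧ I.pos = j * m + k := by
  simp only [oddColl, mem_iUnion, mem_ofPred_eq] at h
  obtain ⟨j, hj, J, ⟨I₀, h0, k, hk, rfl⟩, rfl⟩ := h
  refine ⟨j, k, Int.odd_iff.1 hj, by omega, by exact_mod_cast hk, ?_⟩
  have : I₀.pos = 0 := by
    have h2 : (2 : ℝ) ^ (-I₀.scale) ≠ 0 := by positivity
    exact_mod_cast (mul_eq_zero.1 h0).resolve_left h2
  simp only [shift, this]
  ring

theorem pos_add_ne_of_block {m j j' k k' c : ℤ} (hj : j % 2 = c) (hj' : j' % 2 = c) (hk : 0 ≤ k)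
    (hkm : k < m) (hk' : 0 ≤ k') (hkm' : k' < m) : j * m + k + m ≠ j' * m + k' := by
  intro h
  have e1 : (k + (j + 1) * m) / m = j + 1 := by
    rw [Int.add_mul_ediv_right _ _ (by omega), Int.ediv_eq_zero_of_lt hk hkm, zero_add]
  have e2 : (k' + j' * m) / m = j' := by
    rw [Int.add_mul_ediv_right _ _ (by omega), Int.ediv_eq_zero_of_lt hk' hkm', zero_add]
  have : k + (j + 1) * m = k' + j' * m := by linarith
  rw [this, e2] at e1
  omega

/-- Both parity classes have the property that `τ_m` moves them off themselves. -/
theorem pos_add_ne_of_mem {m : ℕ} {I J : DyadicInterval}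
    (h : I ∈ evenColl m ∧ J ∈ evenColl m ∨ I ∈ oddColl m ∧ J ∈ oddColl m) : I.pos + m ≠ J.pos := by
  rcases h with ⟨h1, h2⟩ | ⟨h1, h2⟩
  · obtain ⟨j, k, hj, hk, hkm, e⟩ := exists_pos_of_mem_evenColl h1
    obtain ⟨j', k', hj', hk', hkm', e'⟩ := exists_pos_of_mem_evenColl h2
    rw [e, e']
    exact pos_add_ne_of_block hj hj' hk hkm hk' hkm'
  · obtain ⟨j, k, hj, hk, hkm, e⟩ := exists_pos_of_mem_oddColl h1
    obtain ⟨j', k', hj', hk', hkm', e'⟩ := exists_pos_of_mem_oddColl h2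
    rw [e, e']
    exact pos_add_ne_of_block hj hj' hk hkm hk' hkm'

theorem scale_sub_of_mem_levelColl {m i : ℕ} {I J : DyadicInterval} (hm : 1 ≤ m)
    (hI : I ∈ levelColl m i) (hJ : J ∈ levelColl m i) (hs : I.scale < J.scale) :
    ∃ k : ℕ, J.scale = I.scale + (splitGap m * (k + 1) : ℕ) := by
  obtain ⟨j, hj⟩ := hI
  obtain ⟨j', hj'⟩ := hJ
  have h4 : 0 < (splitGap m : ℤ) := by have := (splitGap_bounds hm).1; omega
  have hlt : j < j' := by
    rw [hj, hj'] at hs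
    exact lt_of_mul_lt_mul_left (by linarith) h4.le
  refine ⟨(j' - j - 1).toNat, ?_⟩
  push_cast
  rw [Int.toNat_of_nonneg (by omega), hj, hj']
  ring

theorem toSet_subset_iff {I J : DyadicInterval} {e : ℕ} (hs : J.scale = I.scale + e) :
    J.toSet ⊆ I.toSet ↔ 2 ^ e * I.pos ≤ J.pos ∧ J.pos < 2 ^ e * (I.pos + 1) := by
  have hc : (0 : ℝ) < (2 : ℝ) ^ (-J.scale) := by positivity
  have e1 : (2 : ℝ) ^ (-I.scale) = (2 : ℝ) ^ (-J.scale) * 2 ^ e := by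
    rw [← zpow_natCast, ← zpow_add₀ (by norm_num)]
    congr 1; omega
  have hlt : (2 : ℝ) ^ (-J.scale) * J.pos < (2 : ℝ) ^ (-J.scale) * (J.pos + 1) :=
    mul_lt_mul_of_pos_left (by linarith) hc
  constructor
  · intro h
    have h1 : (2 : ℝ) ^ (-J.scale) * J.pos ∈ I.toSet := h ⟨le_rfl, hlt⟩
    simp only [toSet, e1, mem_Ico, mul_assoc] at h1
    have h2 := le_of_mul_le_mul_left h1.1 hc
    have h3 := lt_of_mul_lt_mul_left h1.2 hc.le
    exact ⟨by exact_mod_cast h2, by exact_mod_cast h3⟩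
  · rintro ⟨h1, h2⟩
    have h2' : J.pos + 1 ≤ 2 ^ e * (I.pos + 1) := h2
    simp only [toSet, e1, mul_assoc]
    refine Ico_subset_Ico ?_ ?_ <;> refine mul_le_mul_of_nonneg_left ?_ hc.le
    · exact_mod_cast h1
    · exact_mod_cast h2'

theorem lt_of_mem_levelColl₀ {m i : ℕ} {J : DyadicInterval} (h : J ∈ levelColl₀ m i) :
    J.pos % 2 ^ splitGap m + m < 2 ^ splitGap m := by
  obtain ⟨-, I, -, hlen, h1, h2⟩ := h
  have hs : J.scale = I.scale + splitGap m := by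
    simp only [length] at hlen
    rw [← zpow_add₀ (by norm_num)] at hlen
    have := zpow_right_injective₀ (by norm_num : (0 : ℝ) < 2) (by norm_num) hlen
    omega
  have k1 := (toSet_subset_iff hs).1 h1
  have k2 := (toSet_subset_iff (J := J.shift m) hs).1 h2
  simp only [shift] at k2
  have hΛ : (0 : ℤ) < 2 ^ splitGap m := by positivity
  have hq : J.pos / 2 ^ splitGap m = I.pos := by
    rw [Int.ediv_eq_iff_of_pos hΛ]
    constructor <;> linarith
  have := Int.emod_add_mul_ediv J.pos (2 ^ splitGap m)
  rw [hq] at this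
  linarith

theorem le_of_mem_levelColl₁ {m i : ℕ} {J : DyadicInterval} (h : J ∈ levelColl₁ m i) :
    2 ^ splitGap m ≤ J.pos % 2 ^ splitGap m + m := by
  obtain ⟨⟨j, hj⟩, hJ⟩ := h
  by_contra hlt
  push Not at hlt
  have hΛ : (0 : ℤ) < 2 ^ splitGap m := by positivity
  have h0 := Int.emod_nonneg J.pos hΛ.ne'
  have h1 := Int.emod_add_mul_ediv J.pos (2 ^ splitGap m)
  have hs : J.scale = (J.scale - splitGap m) + splitGap m := by ring
  refine hJ ⟨⟨j, hj⟩, ⟨J.scale - splitGap m, J.pos / 2 ^ splitGap m⟩, ⟨j - 1, ?_⟩, ?_, ?_, ?_⟩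
  · simp only [hj]; ring
  · simp only [length]
    rw [← zpow_add₀ (by norm_num)]
    congr 1; ring
  · refine (toSet_subset_iff hs).2 ⟨by linarith, ?_⟩
    have : (0 : ℤ) ≤ m := by positivity
    linarith
  · refine (toSet_subset_iff (J := J.shift m)
      (I := ⟨J.scale - splitGap m, J.pos / 2 ^ splitGap m⟩) hs).2 ⟨?_, ?_⟩ <;> simp only [shift]
    · have : (0 : ℤ) ≤ m := by positivity
      linarith
    · linarith

/-- The points at `4/12, 5/12, 7/12, 8/12` of a dyadic interval of length `2 ^ (lam * k)` are at
distance at least `1/3` from the integers `b`; all lengths are measured in twelfths. For `k > 0`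
this is because they are thirds of integers, but not integers. -/
theorem third_far_from_int {lam k n : ℕ} {P b : ℤ} (hlam : 4 ≤ lam)
    (hn : n = 4 ∨ n = 4 + 1 ∨ n = 7 ∨ n = 7 + 1) :
    (2 ^ lam) ^ k * (12 * P + n) ≤ 12 * b - 4 ∨ 12 * b + 4 ≤ (2 ^ lam) ^ k * (12 * P + n) := by
  rcases k with _ | k
  · rw [pow_zero, one_mul]
    omega
  · obtain ⟨r, hr⟩ := Nat.exists_eq_add_of_le (by nlinarith : 2 ≤ lam * (k + 1))
    have e : ((2 : ℤ) ^ lam) ^ (k + 1) * (12 * P + n) = 4 * (2 ^ r * (12 * P + n)) := by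
      rw [← pow_mul, hr, pow_add]
      ring
    have h3 : ¬ (3 : ℤ) ∣ 2 ^ r * (12 * P + n) := by
      intro h
      rcases Int.prime_three.dvd_or_dvd h with h | h
      · have := Int.prime_three.dvd_of_dvd_pow h
        omega
      · omega
    rw [e]
    omega

/-- If `J` and `τ_m(J)` lie in different intervals of the preceding generation, then the twelfths
number `4` and `7` of larger intervals do not cut `J ∪ τ_m(J)`. -/
theorem isShiftCompatible_of_level₁ {m i : ℕ} (hm : 1 ≤ m) {𝓒 : Set DyadicInterval}
    (h1 : 𝓒 ⊆ levelColl₁ m i) (h2 : 𝓒 ⊆ evenColl m ∨ 𝓒 ⊆ oddColl m) :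
    IsShiftCompatible m (10 + 2) 4 7 𝓒 where
  pos_ne I hI J hJ _ := pos_add_ne_of_mem (h2.imp (fun h => ⟨h hI, h hJ⟩) fun h => ⟨h hI, h hJ⟩)
  endpoints I hI J hJ hs := by
    obtain ⟨k, hk⟩ := scale_sub_of_mem_levelColl hm (h1 hI).1 (h1 hJ).1 hs
    refine ⟨_, hk, fun P _ n hn => ?_⟩
    obtain ⟨h4, hmΛ⟩ := splitGap_bounds hm
    have hr := le_of_mem_levelColl₁ (h1 hJ)
    have hΛ : (0 : ℤ) < 2 ^ splitGap m := by positivity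
    have hr' := Int.emod_lt_of_pos J.pos hΛ
    have hdiv := Int.emod_add_mul_ediv J.pos (2 ^ splitGap m)
    have key := third_far_from_int (k := k) (P := P) (b := J.pos / 2 ^ splitGap m + 1) h4 hn
    rw [pow_mul, pow_succ']
    set Λ : ℤ := 2 ^ splitGap m
    set q := J.pos / Λ
    push_cast
    have e : Λ * Λ ^ k * (12 * P + n) = Λ * (Λ ^ k * (12 * P + n)) := by ring
    rw [e]
    set w := Λ ^ k * (12 * P + n)
    -- the endpoint `Λ (q + 1)` lies between `J` and `τ_m(J)`, at distance at most `m < Λ / 4`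
    rcases key with key | key
    · left
      have := mul_le_mul_of_nonneg_left key hΛ.le
      linarith
    · right
      have := mul_le_mul_of_nonneg_left key hΛ.le
      have hlt : J.pos + 1 ≤ Λ * (q + 1) := by linarith
      linarith

/-- `J ∪ τ_m(J)` stays away from the first and the last eighth of the dyadic interval of
`2 ^ λ` times the length of `J` that contains `J`. -/
def IsCentral (m : ℕ) (J : DyadicInterval) : Prop :=
  2 ^ splitGap m ≤ 8 * (J.pos % 2 ^ splitGap m) ∧
    8 * (J.pos % 2 ^ splitGap m + m + 1) ≤ 7 * 2 ^ splitGap m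

/-- If `J` and `τ_m(J)` lie in the same interval `Q` of the preceding generation, then the eighths
number `α` and `γ` of larger intervals do not cut `J ∪ τ_m(J)`, provided those of `Q` do not. -/
theorem isShiftCompatible_of_level₀ {m i α γ : ℕ} (hm : 1 ≤ m) {𝓒 : Set DyadicInterval}
    (h1 : 𝓒 ⊆ levelColl₀ m i) (h2 : 𝓒 ⊆ evenColl m ∨ 𝓒 ⊆ oddColl m) (hαγ : α < 8 ∧ γ < 8)
    (h3 : ∀ J ∈ 𝓒, ∀ n : ℕ, (n = α ∨ n = α + 1 ∨ n = γ ∨ n = γ + 1) →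
      2 ^ splitGap m * (n : ℤ) ≤ 8 * (J.pos % 2 ^ splitGap m) ∨
        8 * (J.pos % 2 ^ splitGap m + m + 1) ≤ 2 ^ splitGap m * n) :
    IsShiftCompatible m (6 + 2) α γ 𝓒 where
  pos_ne I hI J hJ _ := pos_add_ne_of_mem (h2.imp (fun h => ⟨h hI, h hJ⟩) fun h => ⟨h hI, h hJ⟩)
  endpoints I hI J hJ hs := by
    obtain ⟨k, hk⟩ := scale_sub_of_mem_levelColl hm (h1 hI).1 (h1 hJ).1 hs
    refine ⟨_, hk, fun P _ n hn => ?_⟩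
    obtain ⟨h4, -⟩ := splitGap_bounds hm
    have hr := lt_of_mem_levelColl₀ (h1 hJ)
    have hΛ : (0 : ℤ) < 2 ^ splitGap m := by positivity
    have hr' := Int.emod_nonneg J.pos hΛ.ne'
    have hdiv := Int.emod_add_mul_ediv J.pos (2 ^ splitGap m)
    have hQ := h3 J hJ n hn
    -- it suffices to locate the endpoint `w / 8` relative to the interval `[q, q + 1]` of `Q`
    have key : (2 ^ splitGap m) ^ k * (8 * P + n) ≤ 8 * (J.pos / 2 ^ splitGap m) ∨
        8 * (J.pos / 2 ^ splitGap m) + 8 ≤ (2 ^ splitGap m) ^ k * (8 * P + n) ∨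
        (2 ^ splitGap m) ^ k * (8 * P + n) = 8 * (J.pos / 2 ^ splitGap m) + n := by
      rcases k with _ | k
      · rw [pow_zero, one_mul]
        omega
      · obtain ⟨r, hr⟩ := Nat.exists_eq_add_of_le (by nlinarith : 3 ≤ splitGap m * (k + 1))
        have e : ((2 : ℤ) ^ splitGap m) ^ (k + 1) * (8 * P + n) = 8 * (2 ^ r * (8 * P + n)) := by
          rw [← pow_mul, hr, pow_add]
          ring
        rw [e]
        omega
    rw [pow_mul, pow_succ']
    set Λ : ℤ := 2 ^ splitGap m
    set q := J.pos / Λ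
    push_cast
    have e : Λ * Λ ^ k * (8 * P + n) = Λ * (Λ ^ k * (8 * P + n)) := by ring
    rw [e]
    set w := Λ ^ k * (8 * P + n)
    rcases key with key | key | key
    · left
      have := mul_le_mul_of_nonneg_left key hΛ.le
      linarith
    · right
      have := mul_le_mul_of_nonneg_left key hΛ.le
      linarith
    · rw [key, mul_add]
      rcases hQ with hQ | hQ
      · left; linarith
      · right; linarith

theorem isShiftCompatible_central {m i : ℕ} (hm : 1 ≤ m) {𝓒 : Set DyadicInterval}
    (h1 : 𝓒 ⊆ levelColl₀ m i) (h2 : 𝓒 ⊆ evenColl m ∨ 𝓒 ⊆ oddColl m)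
    (h3 : ∀ J ∈ 𝓒, IsCentral m J) : IsShiftCompatible m (6 + 2) 0 7 𝓒 := by
  refine isShiftCompatible_of_level₀ hm h1 h2 (by norm_num) fun J hJ n hn => ?_
  obtain ⟨h5, h6⟩ := h3 J hJ
  have hΛ : (0 : ℤ) < 2 ^ splitGap m := by positivity
  have hr' := Int.emod_nonneg J.pos hΛ.ne'
  have hr := lt_of_mem_levelColl₀ (h1 hJ)
  rcases hn with rfl | rfl | rfl | rfl <;> push_cast <;> omega

/-- As `J ∪ τ_m(J)` has at most a quarter of the length of the interval of the preceding generation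
that contains it, it misses the two middle eighths when it meets an outer one. -/
theorem isShiftCompatible_not_central {m i : ℕ} (hm : 1 ≤ m) {𝓒 : Set DyadicInterval}
    (h1 : 𝓒 ⊆ levelColl₀ m i) (h2 : 𝓒 ⊆ evenColl m ∨ 𝓒 ⊆ oddColl m)
    (h3 : ∀ J ∈ 𝓒, ¬ IsCentral m J) : IsShiftCompatible m (6 + 2) 3 4 𝓒 := by
  refine isShiftCompatible_of_level₀ hm h1 h2 (by norm_num) fun J hJ n hn => ?_
  have h5 := h3 J hJ
  obtain ⟨h4, hmΛ⟩ := splitGap_bounds hm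
  obtain ⟨r, hr⟩ := Nat.exists_eq_add_of_le h4
  have hd : (2 : ℤ) ^ splitGap m = 16 * 2 ^ r := by rw [hr, pow_add]; norm_num
  rw [IsCentral, not_and_or, not_le, not_le] at h5
  rw [hd] at h5 hmΛ ⊢
  rcases hn with rfl | rfl | rfl | rfl <;> push_cast <;> omega

theorem splitColl₀_subset {m i : ℕ} : ∃ i', splitColl₀ m i ⊆ levelColl₀ m i' ∧
    (splitColl₀ m i ⊆ evenColl m ∨ splitColl₀ m i ⊆ oddColl m) := by
  unfold splitColl₀
  split_ifs
  · exact ⟨_, inter_subset_left, Or.inl inter_subset_right⟩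
  · exact ⟨_, inter_subset_left, Or.inr inter_subset_right⟩

theorem splitColl₁_subset {m i : ℕ} : ∃ i', splitColl₁ m i ⊆ levelColl₁ m i' ∧
    (splitColl₁ m i ⊆ evenColl m ∨ splitColl₁ m i ⊆ oddColl m) := by
  unfold splitColl₁
  split_ifs
  · exact ⟨_, inter_subset_left, Or.inl inter_subset_right⟩
  · exact ⟨_, inter_subset_left, Or.inr inter_subset_right⟩

theorem lastIndex_le {m : ℕ} (hm : 1 ≤ m) : (lastIndex m : ℝ) ≤ 7 + 2 * Real.logb 2 m := by
  rcases hm.eq_or_lt with rfl | hm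
  · simp [lastIndex, lastLevel, splitGap]
  · have h : splitGap m = Nat.log 2 m + 3 := if_neg (by omega)
    have e : lastIndex m = 2 * Nat.log 2 m + 5 := by
      simp only [lastIndex, lastLevel, h]; omega
    have := Real.natLog_le_logb m 2
    rw [e]
    push_cast at this ⊢
    linarith

/-! ### Elementary tensors and Haar coefficients in `L^p_X` -/

section Lp

variable {X : Type*} [NormedAddCommGroup X] [NormedSpace ℝ X] {p : ℝ≥0∞}

theorem IsBddFun.memLp_smul {f : ℝ → ℝ} (hf : IsBddFun f) (x : X) :
    MemLp (fun t => f t • x) p volume := by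
  obtain ⟨R, hR⟩ := hf.support_bounded
  have h : MemLp (fun t => f t • x) p (volume.restrict (Icc (-R) R)) :=
    memLp_smul_const_of_bounded hf.measurable hf.bounded x
  rw [← memLp_indicator_iff_restrict measurableSet_Icc] at h
  convert h using 1
  symm
  rw [indicator_eq_self]
  exact fun t ht => abs_le.1 (hR t fun h0 => ht (by simp [h0]))

variable [Fact (1 ≤ p)]

/-- `x ↦ f ⊗ x`, from `X` to `L^p_X`. -/
noncomputable def tensorL (p : ℝ≥0∞) [Fact (1 ≤ p)] (X : Type*) [NormedAddCommGroup X]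
    [NormedSpace ℝ X] {f : ℝ → ℝ} (hf : IsBddFun f) : X →L[ℝ] Lp X p (volume : Measure ℝ) :=
  LinearMap.mkContinuous
    { toFun := fun x => (hf.memLp_smul x).toLp
      map_add' := fun x y => by
        rw [← MemLp.toLp_add]
        exact MemLp.toLp_congr _ _ (Filter.Eventually.of_forall fun t => smul_add _ _ _)
      map_smul' := fun c x => by
        rw [RingHom.id_apply, ← MemLp.toLp_const_smul]
        exact MemLp.toLp_congr _ _ (Filter.Eventually.of_forall fun t => smul_comm _ _ _) }
    (eLpNorm (fun t => f t • (1 : ℝ)) p volume).toReal fun x => by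
      have hfin : eLpNorm (fun t => f t • (1 : ℝ)) p volume ≠ ∞ := (hf.memLp_smul 1).2.ne
      change ‖(hf.memLp_smul x).toLp‖ ≤ _
      rw [Lp.norm_toLp]
      have h := eLpNorm_le_mul_eLpNorm_of_ae_le_mul (μ := volume) (f := fun t => f t • x)
        (g := fun t => f t • (1 : ℝ)) (c := ‖x‖)
        (Filter.Eventually.of_forall fun t => by simp [norm_smul, mul_comm]) p
      refine (ENNReal.toReal_mono (ENNReal.mul_ne_top ENNReal.ofReal_ne_top hfin) h).trans_eq ?_
      rw [ENNReal.toReal_mul, ENNReal.toReal_ofReal (norm_nonneg x), mul_comm]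

theorem tensorL_apply {f : ℝ → ℝ} (hf : IsBddFun f) (x : X) :
    tensorL p X hf x = (hf.memLp_smul x).toLp := rfl

theorem coeFn_tensorL {f : ℝ → ℝ} (hf : IsBddFun f) (x : X) :
    tensorL p X hf x =ᵐ[volume] fun t => f t • x := (hf.memLp_smul x).coeFn_toLp

theorem tensorL_eq_add {f g h : ℝ → ℝ} (hf : IsBddFun f) (hg : IsBddFun g) (hh : IsBddFun h)
    {a b : ℝ} (e : ∀ t, f t = a * g t + b * h t) (x : X) :
    tensorL p X hf x = a • tensorL p X hg x + b • tensorL p X hh x := by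
  rw [tensorL_apply, tensorL_apply, tensorL_apply, ← MemLp.toLp_const_smul,
    ← MemLp.toLp_const_smul, ← MemLp.toLp_add]
  refine MemLp.toLp_congr _ _ (Filter.Eventually.of_forall fun t => ?_)
  simp [e, add_smul, mul_smul]

theorem coeFn_sum_tensorL {ι : Type*} {f : ι → ℝ → ℝ} (hf : ∀ i, IsBddFun (f i)) (F : Finset ι)
    (x : ι → X) : (∑ i ∈ F, tensorL p X (hf i) (x i) : Lp X p (volume : Measure ℝ)) =ᵐ[volume]
      fun t => ∑ i ∈ F, f i t • x i := by
  classical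
  induction F using Finset.induction_on with
  | empty => exact Lp.coeFn_zero X p volume
  | insert i F hi ih =>
    rw [Finset.sum_insert hi]
    filter_upwards [Lp.coeFn_add (tensorL p X (hf i) (x i)) (∑ i ∈ F, tensorL p X (hf i) (x i)),
      ih, coeFn_tensorL (p := p) (hf i) (x i)] with t h1 h2 h3
    rw [h1, Pi.add_apply, h2, h3, Finset.sum_insert hi]

theorem enorm_sum_tensorL {ι : Type*} {f : ι → ℝ → ℝ} (hf : ∀ i, IsBddFun (f i)) (F : Finset ι)
    (x : ι → X) : ‖∑ i ∈ F, tensorL p X (hf i) (x i)‖ₑ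
      = sumNorm p (fun i : F => x i) fun i : F => f i := by
  rw [Lp.enorm_def, eLpNorm_congr_ae (coeFn_sum_tensorL hf F x), sumNorm]
  congr 1
  funext t
  exact (Finset.sum_coe_sort F fun i => f i t • x i).symm

theorem abs_haar_le_one (I : DyadicInterval) (t : ℝ) : |I.haar t| ≤ 1 := by
  rw [haar_eq_floor]
  split_ifs <;> simp

theorem integrable_haar_smul {u : ℝ → X} {I : DyadicInterval}
    (hu : Integrable u (volume.restrict I.toSet)) : Integrable fun t => I.haar t • u t := by
  rw [← integrableOn_iff_integrable_of_support_subset (s := I.toSet)]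
  · exact hu.bdd_smul 1 (isBlock_haar I).measurable.aestronglyMeasurable
      (Filter.Eventually.of_forall fun t => abs_haar_le_one I t)
  · exact fun t ht => support_haar_subset I fun h0 => ht (by simp [h0])

theorem enorm_haarCoeff_le (u : Lp X p (volume : Measure ℝ)) (I : DyadicInterval) :
    ‖haarCoeff u I‖ₑ
      ≤ ‖u‖ₑ * volume I.toSet ^ (1 / (1 : ℝ≥0∞).toReal - 1 / p.toReal) := by
  have hI : ∀ t, ‖I.haar t • u t‖ₑ ≤ I.toSet.indicator (fun t => ‖u t‖ₑ) t := by
    intro t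
    by_cases ht : t ∈ I.toSet
    · rw [indicator_of_mem ht, enorm_smul]
      refine mul_le_of_le_one_left' ?_
      rw [← ofReal_norm, ENNReal.ofReal_le_one]
      exact abs_haar_le_one I t
    · have : I.haar t = 0 := Function.support_subset_iff'.1 (support_haar_subset I) t ht
      simp [this]
  calc ‖haarCoeff u I‖ₑ ≤ ∫⁻ t, ‖I.haar t • u t‖ₑ := enorm_integral_le_lintegral_enorm _
    _ ≤ ∫⁻ t, I.toSet.indicator (fun t => ‖u t‖ₑ) t := lintegral_mono hI
    _ = ∫⁻ t in I.toSet, ‖u t‖ₑ := lintegral_indicator I.measurableSet_toSet _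
    _ = eLpNorm (fun t => u t) 1 (volume.restrict I.toSet) := eLpNorm_one_eq_lintegral_enorm.symm
    _ ≤ eLpNorm u p (volume.restrict I.toSet)
          * (volume.restrict I.toSet) univ ^ (1 / (1 : ℝ≥0∞).toReal - 1 / p.toReal) :=
        eLpNorm_le_eLpNorm_mul_rpow_measure_univ Fact.out (Lp.memLp u).1.restrict
    _ ≤ ‖u‖ₑ * volume I.toSet ^ (1 / (1 : ℝ≥0∞).toReal - 1 / p.toReal) := by
        rw [Measure.restrict_apply_univ, Lp.enorm_def]
        gcongr
        exact Measure.restrict_le_self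

/-- The Haar coefficient `u ↦ ⟨u, h_I⟩` as a bounded operator from `L^p_X` to `X`. -/
noncomputable def haarCoeffL (X : Type*) [NormedAddCommGroup X] [NormedSpace ℝ X]
    (I : DyadicInterval) : Lp X p (volume : Measure ℝ) →L[ℝ] X :=
  LinearMap.mkContinuous
    { toFun := fun u => haarCoeff u I
      map_add' := fun u v => by
        have hi : ∀ w : Lp X p (volume : Measure ℝ), Integrable fun t => I.haar t • w t := fun w =>
          have : IsFiniteMeasure (volume.restrict I.toSet) := ⟨by simp [volume_toSet]⟩
          integrable_haar_smul
            (memLp_one_iff_integrable.1 (((Lp.memLp w).restrict _).mono_exponent Fact.out))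
        rw [haarCoeff, haarCoeff, haarCoeff, ← integral_add (hi u) (hi v)]
        refine integral_congr_ae ?_
        filter_upwards [Lp.coeFn_add u v] with t ht
        rw [ht, Pi.add_apply, smul_add]
      map_smul' := fun c u => by
        rw [haarCoeff, haarCoeff, RingHom.id_apply, ← integral_smul]
        refine integral_congr_ae ?_
        filter_upwards [Lp.coeFn_smul c u] with t ht
        rw [ht, Pi.smul_apply, smul_comm] }
    (volume I.toSet ^ (1 / (1 : ℝ≥0∞).toReal - 1 / p.toReal)).toReal fun u => by
      have hv0 : volume I.toSet ≠ 0 := by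
        rw [volume_toSet, Ne, ENNReal.ofReal_eq_zero, not_le]; exact I.length_pos
      have hvt : volume I.toSet ≠ ∞ := by rw [volume_toSet]; exact ENNReal.ofReal_ne_top
      have hc := ENNReal.rpow_ne_top_of_ne_zero hv0 hvt
        (y := 1 / (1 : ℝ≥0∞).toReal - 1 / p.toReal)
      have h := ENNReal.toReal_mono (ENNReal.mul_ne_top enorm_ne_top hc) (enorm_haarCoeff_le u I)
      rw [ENNReal.toReal_mul, toReal_enorm, toReal_enorm, mul_comm] at h
      exact h

theorem haarCoeffL_apply (I : DyadicInterval) (u : Lp X p (volume : Measure ℝ)) :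
    haarCoeffL X I u = haarCoeff u I := rfl

/-- `x ↦ h_I ⊗ x` -/
noncomputable def haarL (p : ℝ≥0∞) [Fact (1 ≤ p)] (X : Type*) [NormedAddCommGroup X]
    [NormedSpace ℝ X] (I : DyadicInterval) : X →L[ℝ] Lp X p (volume : Measure ℝ) :=
  tensorL p X (isBlock_haar I).toIsBddFun

theorem haarCoeff_haarL [CompleteSpace X] (I J : DyadicInterval) (x : X) :
    haarCoeff (haarL p X I x) J = (∫ t, J.haar t * I.haar t) • x := by
  rw [haarCoeff, ← integral_smul_const]
  refine integral_congr_ae ?_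
  filter_upwards [coeFn_tensorL (p := p) (isBlock_haar I).toIsBddFun x] with t ht
  rw [haarL, ht, smul_smul]

theorem haarCoeff_haarL_self [CompleteSpace X] (I : DyadicInterval) (x : X) :
    haarCoeff (haarL p X I x) I = I.length • x := by
  rw [haarCoeff_haarL, integral_haar_mul_self]

theorem haarCoeff_haarL_of_ne [CompleteSpace X] {I J : DyadicInterval} (h : I ≠ J) (x : X) :
    haarCoeff (haarL p X I x) J = 0 := by
  rw [haarCoeff_haarL, integral_haar_mul_haar_of_ne _ _ h, zero_smul]

theorem haarTerm_eq (u : Lp X p (volume : Measure ℝ)) (I : DyadicInterval) :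
    haarTerm u I = haarL p X I (I.length⁻¹ • haarCoeff u I) := by
  rw [map_smul]
  rfl

theorem isBddFun_rearrangedHaar (m : ℤ) (I : DyadicInterval) : IsBddFun (rearrangedHaar m I) :=
  (isPiece_Ico _ _).isBddFun.sub (isPiece_Ico _ _).isBddFun

/-- `x ↦ (1_{τ_m(I)} - 1_I) ⊗ x` -/
noncomputable def rearrangedL (p : ℝ≥0∞) [Fact (1 ≤ p)] (X : Type*) [NormedAddCommGroup X]
    [NormedSpace ℝ X] (m : ℤ) (I : DyadicInterval) : X →L[ℝ] Lp X p (volume : Measure ℝ) :=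
  tensorL p X (isBddFun_rearrangedHaar m I)

theorem rearrangedTerm_eq (m : ℤ) (u : Lp X p (volume : Measure ℝ)) (I : DyadicInterval) :
    rearrangedTerm m u I = rearrangedL p X m I (I.length⁻¹ • haarCoeff u I) := by
  rw [map_smul]
  rfl

/-! ### Density of the Haar system -/

/-- The finite Haar sums with coefficients in `X`. -/
noncomputable def haarSum (p : ℝ≥0∞) [Fact (1 ≤ p)] (X : Type*) [NormedAddCommGroup X]
    [NormedSpace ℝ X] : (DyadicInterval →₀ X) →ₗ[ℝ] Lp X p (volume : Measure ℝ) :=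
  Finsupp.lsum ℝ fun I => (haarL p X I).toLinearMap

theorem haarSum_apply (f : DyadicInterval →₀ X) :
    haarSum p X f = ∑ I ∈ f.support, haarL p X I (f I) := rfl

theorem haarL_mem_range (I : DyadicInterval) (x : X) :
    haarL p X I x ∈ LinearMap.range (haarSum p X) :=
  ⟨Finsupp.single I x, by simp [haarSum]⟩

theorem isBddFun_indicator_toSet (I : DyadicInterval) : IsBddFun (I.toSet.indicator 1) :=
  (isPiece_Ico _ _).isBddFun

theorem indicator_eq_pred (I : DyadicInterval) : ∃ c : ℝ, ∀ t,
    I.toSet.indicator 1 t = 2⁻¹ * I.pred.toSet.indicator 1 t + c * I.pred.haar t := by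
  have hc : (0 : ℝ) < (2 : ℝ) ^ (-I.scale) := by positivity
  have h1 : (2 : ℝ) ^ (-(I.scale - 1)) = 2 * (2 : ℝ) ^ (-I.scale) := by
    rw [show -(I.scale - 1) = -I.scale + 1 by ring, zpow_add₀ (by norm_num)]
    ring
  set d : ℝ := (2 : ℝ) ^ (-I.scale) with hd
  set q : ℤ := I.pos / 2 with hq
  have e1 : I.pred.toSet = Ico (2 * d * q) (2 * d * q + 2 * d) := by
    simp only [toSet, pred, h1]
    congr 1
    ring
  have e2 : I.pred.haar = fun t => (Ico (2 * d * q) (2 * d * q + d)).indicator (fun _ => (1 : ℝ)) t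
      - (Ico (2 * d * q + d) (2 * d * q + 2 * d)).indicator (fun _ => (1 : ℝ)) t := by
    rw [haar_eq]
    simp only [left, length, pred, h1, ← hq]
    rw [show 2 * d / 2 = d by ring]
  rcases (by omega : I.pos = 2 * q ∨ I.pos = 2 * q + 1) with h | h
  · have e0 : I.toSet = Ico (2 * d * q) (2 * d * q + d) := by
      simp only [toSet, h]
      push_cast
      congr 1 <;> ring
    refine ⟨2⁻¹, fun t => ?_⟩
    rw [e0, e1, e2]
    simp only [indicator, mem_Ico, Pi.one_apply]
    split_ifs <;> grind
  · have e0 : I.toSet = Ico (2 * d * q + d) (2 * d * q + 2 * d) := by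
      simp only [toSet, h]
      push_cast
      congr 1 <;> ring
    refine ⟨-2⁻¹, fun t => ?_⟩
    rw [e0, e1, e2]
    simp only [indicator, mem_Ico, Pi.one_apply]
    split_ifs <;> grind

theorem norm_tensorL_indicator (hp : p ≠ ∞) (I : DyadicInterval) (x : X) :
    ‖tensorL p X (isBddFun_indicator_toSet I) x‖ = ‖x‖ * I.length ^ (1 / p.toReal) := by
  have hp0 : p ≠ 0 := (zero_lt_one.trans_le (Fact.out : 1 ≤ p)).ne'
  have e : (fun t => I.toSet.indicator (1 : ℝ → ℝ) t • x) = I.toSet.indicator fun _ => x := by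
    funext t
    by_cases ht : t ∈ I.toSet <;> simp [ht]
  rw [tensorL_apply, Lp.norm_toLp]
  simp_rw [e]
  rw [eLpNorm_indicator_const I.measurableSet_toSet hp0 hp, ENNReal.toReal_mul, toReal_enorm,
    ← ENNReal.toReal_rpow, volume_toSet, ENNReal.toReal_ofReal I.length_pos.le]

/-- Indicator functions of dyadic intervals are limits of Haar sums: passing to the predecessor
halves the function modulo Haar functions, and `2⁻ⁿ` times the indicator function of the `n`-th
predecessor tends to zero in `L^p` because `p > 1`. -/
theorem tensorL_indicator_mem_closure (hp1 : 1 < p) (hp : p ≠ ∞) (I : DyadicInterval) (x : X) :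
    tensorL p X (isBddFun_indicator_toSet I) x
      ∈ (LinearMap.range (haarSum p X)).topologicalClosure := by
  set V := LinearMap.range (haarSum p X)
  let S : ℕ → Lp X p (volume : Measure ℝ) := fun n =>
    tensorL p X (isBddFun_indicator_toSet (pred^[n] I)) x
  have hV : ∀ n : ℕ, S 0 - ((2 : ℝ)⁻¹ ^ n) • S n ∈ V := by
    intro n
    induction n with
    | zero => simp
    | succ n ih =>
      obtain ⟨c, hc⟩ := indicator_eq_pred (pred^[n] I)
      have hn : S n = (2⁻¹ : ℝ) • S (n + 1) + c • haarL p X (pred^[n] I).pred x := by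
        have e : (pred^[n] I).pred = pred^[n + 1] I := (Function.iterate_succ_apply' _ _ _).symm
        rw [e] at hc ⊢
        exact tensorL_eq_add _ _ _ hc x
      have e : S 0 - ((2 : ℝ)⁻¹ ^ (n + 1)) • S (n + 1) = (S 0 - ((2 : ℝ)⁻¹ ^ n) • S n)
          + ((2 : ℝ)⁻¹ ^ n * c) • haarL p X (pred^[n] I).pred x := by
        rw [hn, smul_add, smul_smul, smul_smul, pow_succ]
        abel
      rw [e]
      exact V.add_mem ih (V.smul_mem _ (haarL_mem_range _ x))
  have hlen : ∀ n : ℕ, (pred^[n] I).length = 2 ^ n * I.length := by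
    intro n
    induction n with
    | zero => simp
    | succ n ih =>
      rw [Function.iterate_succ_apply', length_pred, ih, pow_succ]
      ring
  have hr : 1 / p.toReal < 1 := by
    have h1 : 1 < p.toReal := by
      rw [← ENNReal.toReal_one]
      exact (ENNReal.toReal_lt_toReal ENNReal.one_ne_top hp).2 hp1
    rw [div_lt_one (by linarith)]
    exact h1
  have hlim : Filter.Tendsto (fun n : ℕ => ((2 : ℝ)⁻¹ ^ n) • S n) Filter.atTop (nhds 0) := by
    rw [tendsto_zero_iff_norm_tendsto_zero]
    have hn : ∀ n : ℕ, ‖((2 : ℝ)⁻¹ ^ n) • S n‖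
        = (2⁻¹ * (2 : ℝ) ^ (1 / p.toReal)) ^ n * (‖x‖ * I.length ^ (1 / p.toReal)) := by
      intro n
      rw [norm_smul, norm_tensorL_indicator hp, hlen, Real.mul_rpow (by positivity)
        I.length_pos.le, Real.norm_of_nonneg (by positivity), mul_pow,
        ← Real.rpow_natCast_mul (by norm_num), mul_comm (n : ℝ), Real.rpow_mul_natCast (by norm_num)]
      ring
    simp_rw [hn]
    rw [← zero_mul (‖x‖ * I.length ^ (1 / p.toReal))]
    refine (tendsto_pow_atTop_nhds_zero_of_lt_one (by positivity) ?_).mul_const _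
    have : (2 : ℝ) ^ (1 / p.toReal) < 2 ^ (1 : ℝ) :=
      Real.rpow_lt_rpow_of_exponent_lt (by norm_num) hr
    rw [Real.rpow_one] at this
    linarith
  have hlim' := (tendsto_const_nhds (x := S 0)).sub hlim
  rw [sub_zero] at hlim'
  exact mem_closure_of_tendsto hlim' (Filter.Eventually.of_forall hV)

/-- On a fine dyadic grid, a continuous function of compact support is uniformly close to a step
function. -/
theorem toLp_mem_closure_of_continuous (hp1 : 1 < p) (hp : p ≠ ∞) {g : ℝ → X}
    (hg : Continuous g) (hc : HasCompactSupport g) (hm : MemLp g p volume) :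
    hm.toLp ∈ (LinearMap.range (haarSum p X)).topologicalClosure := by
  set W := (LinearMap.range (haarSum p X)).topologicalClosure
  obtain ⟨R, hR⟩ := hc.isCompact.isBounded.exists_norm_le
  obtain ⟨N, hN⟩ := exists_nat_gt R
  have hg0 : ∀ t, t ∉ Ico (-(N : ℝ)) N → g t = 0 := by
    intro t ht
    by_contra hne
    have h1 := (hR t (subset_tsupport g hne)).trans_lt hN
    rw [Real.norm_eq_abs, abs_lt] at h1
    exact ht ⟨h1.1.le, h1.2⟩
  refine (LinearMap.range (haarSum p X)).isClosed_topologicalClosure.closure_subset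
    (Metric.mem_closure_iff.2 fun ε hε => ?_)
  set v : ℝ := (volume (Ico (-(N : ℝ)) N) ^ p.toReal⁻¹).toReal
  have hvt : volume (Ico (-(N : ℝ)) N) ^ p.toReal⁻¹ ≠ ∞ :=
    ENNReal.rpow_ne_top_of_nonneg (by positivity) (by simp)
  have hv : 0 ≤ v := ENNReal.toReal_nonneg
  obtain ⟨δ, hδ, hδg⟩ := Metric.uniformContinuous_iff.1
    (hc.uniformContinuous_of_continuous hg) (ε / (v + 1)) (by positivity)
  obtain ⟨n, hn⟩ := exists_pow_lt_of_lt_one hδ (by norm_num : (2 : ℝ)⁻¹ < 1)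
  let K : Finset ℤ := Finset.Ico (-(N * 2 ^ n : ℤ)) (N * 2 ^ n)
  let D : ℤ → DyadicInterval := fun k => ⟨n, k⟩
  have hD : ∀ (k : ℤ) (t : ℝ), t ∈ (D k).toSet ↔ ⌊(2 : ℝ) ^ n * t⌋ = k := by
    intro k t
    have h2 : (0 : ℝ) < 2 ^ n := by positivity
    simp only [D, toSet, mem_Ico, zpow_neg, zpow_natCast, Int.floor_eq_iff]
    rw [inv_mul_le_iff₀ h2, lt_inv_mul_iff₀ h2]
  let w : Lp X p (volume : Measure ℝ) :=
    ∑ k ∈ K, tensorL p X (isBddFun_indicator_toSet (D k)) (g ((2 : ℝ)⁻¹ ^ n * k))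
  have hwW : w ∈ W := W.sum_mem fun k _ => tensorL_indicator_mem_closure hp1 hp _ _
  refine ⟨w, hwW, ?_⟩
  have hstep : ∀ t, ∑ k ∈ K, (D k).toSet.indicator (1 : ℝ → ℝ) t • g ((2 : ℝ)⁻¹ ^ n * k)
      = if t ∈ Ico (-(N : ℝ)) N then g ((2 : ℝ)⁻¹ ^ n * ⌊(2 : ℝ) ^ n * t⌋) else 0 := by
    intro t
    have hK : ⌊(2 : ℝ) ^ n * t⌋ ∈ K ↔ t ∈ Ico (-(N : ℝ)) N := by
      have h2 : (0 : ℝ) < 2 ^ n := by positivity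
      simp only [K, Finset.mem_Ico, Int.le_floor, Int.floor_lt, mem_Ico]
      push_cast
      rw [mul_comm (N : ℝ), ← mul_neg, mul_le_mul_iff_right₀ h2, mul_lt_mul_iff_right₀ h2]
    have hz : ∀ k, k ≠ ⌊(2 : ℝ) ^ n * t⌋ →
        (D k).toSet.indicator (1 : ℝ → ℝ) t • g ((2 : ℝ)⁻¹ ^ n * k) = 0 := fun k hk => by
      rw [indicator_of_notMem fun h => hk ((hD k t).1 h).symm, zero_smul]
    split_ifs with ht
    · rw [Finset.sum_eq_single_of_mem _ (hK.2 ht) fun k _ hk => hz k hk,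
        indicator_of_mem ((hD _ t).2 rfl), Pi.one_apply, one_smul]
    · exact Finset.sum_eq_zero fun k hk => hz k fun h => ht (hK.1 (h ▸ hk))
  let e : ℝ → X := fun t => g t - ∑ k ∈ K, (D k).toSet.indicator (1 : ℝ → ℝ) t • g ((2 : ℝ)⁻¹ ^ n * k)
  have he0 : Function.support e ⊆ Ico (-(N : ℝ)) N := by
    refine Function.support_subset_iff'.2 fun t ht => ?_
    simp only [e, hstep, if_neg ht, hg0 t ht, sub_zero]
  have heb : ∀ t, ‖e t‖ ≤ ε / (v + 1) := by
    intro t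
    simp only [e, hstep]
    split_ifs with ht
    · rw [← dist_eq_norm]
      refine (hδg ?_).le
      have h2 : (0 : ℝ) < 2⁻¹ ^ n := by positivity
      have h3 : (2 : ℝ)⁻¹ ^ n * 2 ^ n = 1 := by rw [← mul_pow]; norm_num
      have h4 : t - (2 : ℝ)⁻¹ ^ n * ⌊(2 : ℝ) ^ n * t⌋ = 2⁻¹ ^ n * Int.fract ((2 : ℝ) ^ n * t) := by
        rw [Int.fract, mul_sub, ← mul_assoc, h3, one_mul]
      rw [Real.dist_eq, h4, abs_of_nonneg (mul_nonneg h2.le (Int.fract_nonneg _))]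
      refine lt_of_le_of_lt ?_ hn
      exact mul_le_of_le_one_right h2.le (Int.fract_lt_one _).le
    · rw [hg0 t ht, sub_zero, norm_zero]; positivity
  rw [dist_eq_norm, Lp.norm_def]
  have hae : (hm.toLp - w : Lp X p (volume : Measure ℝ)) =ᵐ[volume] e := by
    filter_upwards [Lp.coeFn_sub hm.toLp w, hm.coeFn_toLp,
      coeFn_sum_tensorL (p := p) (fun k => isBddFun_indicator_toSet (D k)) K
        fun k => g ((2 : ℝ)⁻¹ ^ n * k)] with t h1 h2 h3
    rw [h1, Pi.sub_apply, h2, h3]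
  rw [eLpNorm_congr_ae hae, ← eLpNorm_restrict_eq_of_support_subset he0]
  have hb := eLpNorm_le_of_ae_bound (p := p) (μ := volume.restrict (Ico (-(N : ℝ)) N))
    (Filter.Eventually.of_forall heb)
  rw [Measure.restrict_apply_univ] at hb
  refine (ENNReal.toReal_mono (ENNReal.mul_ne_top hvt ENNReal.ofReal_ne_top) hb).trans_lt ?_
  rw [ENNReal.toReal_mul, ENNReal.toReal_ofReal (by positivity)]
  change v * (ε / (v + 1)) < ε
  rw [mul_div_assoc', div_lt_iff₀ (by positivity)]
  nlinarith

/-- The finite Haar sums are dense in `L^p_X(ℝ)`, `1 < p < ∞`. -/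
theorem denseRange_haarSum (hp1 : 1 < p) (hp : p ≠ ∞) : DenseRange (haarSum p X) := by
  intro u
  have hW : u ∈ (LinearMap.range (haarSum p X)).topologicalClosure := by
    refine (LinearMap.range (haarSum p X)).isClosed_topologicalClosure.closure_subset
      (Metric.mem_closure_iff.2 fun ε hε => ?_)
    obtain ⟨g, hc, hg, hgc, hm⟩ := (Lp.memLp u).exists_hasCompactSupport_eLpNorm_sub_le hp
      (ε := ENNReal.ofReal (ε / 2)) (by simpa using hε)
    refine ⟨hm.toLp, toLp_mem_closure_of_continuous hp1 hp hgc hc hm, ?_⟩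
    rw [dist_eq_norm, ← Lp.toLp_coeFn u (Lp.memLp u), ← MemLp.toLp_sub, Lp.norm_toLp]
    refine (ENNReal.toReal_le_of_le_ofReal (by positivity) hg).trans_lt (by linarith)
  exact hW

end Lp

/-! ### Unconditional convergence and the estimate for series -/

section Series

/-- The infimum defining `𝒰_p(X)` need not be attained a priori, whence the summand `1`, which
also makes the bound at least `1`. -/
theorem exists_umdBound {p : ℝ≥0∞} {X : Type*} [NormedAddCommGroup X] [NormedSpace ℝ X]
    [CompleteSpace X] (h : umdConst p X < ∞) : IsUMDBound p X (umdConst p X + 1) := by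
  have hlt : umdConst p X < umdConst p X + 1 := ENNReal.lt_add_right h.ne one_ne_zero
  obtain ⟨β, hβ, hlt⟩ := sInf_lt_iff.1 hlt
  intro Ω m0 μ hμ ℱ d hd ε hε n
  exact (hβ Ω m0 μ hμ ℱ d hd ε hε n).trans (by gcongr)

theorem constOnFiner_haar (F : Finset DyadicInterval) :
    ConstOnFiner (fun I : F => I.1.scale) (fun I : F => I.1.toSet) fun I : F => haar I := by
  intro I J hIJ hr
  rcases hr.lt_or_eq with hr | hr
  · exact constOn_haar hr
  · have hne : I.1.pos ≠ J.1.pos := fun h => hIJ (Subtype.ext (DyadicInterval.ext hr h))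
    refine constOn_of_disjoint_support fun t ht => ?_
    refine Function.support_subset_iff'.1 (support_haar_subset _) t fun hh => ?_
    exact disjoint_left.1 (disjoint_toSet hr hne) hh ht

variable {X : Type*} [NormedAddCommGroup X] [NormedSpace ℝ X] [CompleteSpace X]
  {p β : ℝ≥0∞} [Fact (1 ≤ p)]

/-- The Haar system is unconditional in `L^p_X`. -/
theorem enorm_sum_haarL_le_of_subset (hp : p ≠ ∞) (hβ : IsUMDBound p X β) (hβ1 : 1 ≤ β)
    {F G : Finset DyadicInterval} (hFG : F ⊆ G) (x : DyadicInterval → X) :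
    ‖∑ I ∈ F, haarL p X I (x I)‖ₑ ≤ β * ‖∑ I ∈ G, haarL p X I (x I)‖ₑ := by
  classical
  simp only [haarL]
  rw [enorm_sum_tensorL (fun I => (isBlock_haar I).toIsBddFun),
    enorm_sum_tensorL (fun I => (isBlock_haar I).toIsBddFun)]
  let A : G → ℝ → ℝ := fun I => if I.1 ∈ F then haar I else 0
  let B : G → ℝ → ℝ := fun I => if I.1 ∈ F then 0 else haar I
  have eA : sumNorm p (fun I : F => x I) (fun I : F => haar I)
      = sumNorm p (fun I : G => x I) A := by
    unfold sumNorm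
    congr 1
    funext t
    rw [Finset.sum_coe_sort F fun I => haar I t • x I,
      Finset.sum_coe_sort G fun I => (if I ∈ F then haar I else 0) t • x I]
    rw [← Finset.sum_subset hFG]
    · exact Finset.sum_congr rfl fun I hI => by rw [if_pos hI]
    · intro I _ hI
      rw [if_neg hI, Pi.zero_apply, zero_smul]
  have eAB : A + B = fun I : G => haar I := by
    funext I
    by_cases h : I.1 ∈ F <;> simp [A, B, h]
  have hc := constOnFiner_haar G
  rw [eA, ← eAB]
  refine sumNorm_left_le_sumNorm_add Fact.out hp hβ hβ1 (S := fun I : G => I.1.toSet)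
    (rank := fun I : G => I.1.scale) (fun I => ?_) (fun I => ?_) (fun I => ?_) (fun I => ?_)
    (fun I => ?_) (fun I J hIJ hr => ?_) (fun I J hIJ hr => ?_) _
  all_goals by_cases h : I.1 ∈ F <;> simp only [A, B, h, if_true, if_false]
  any_goals first
    | exact isBlock_zero
    | exact isBlock_haar I
    | exact support_haar_subset I
    | exact hc I J hIJ hr
    | exact fun _ _ _ _ => rfl
  all_goals simp [ConstOn]

theorem sum_haarTerm_haarSum (f : DyadicInterval →₀ X) (F : Finset DyadicInterval) :
    ∑ J ∈ F, haarTerm (haarSum p X f) J = ∑ J ∈ F, haarL p X J (f J) := by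
  classical
  refine Finset.sum_congr rfl fun J _ => ?_
  have h : haarCoeff (haarSum p X f) J = J.length • f J := by
    rw [← haarCoeffL_apply, haarSum_apply, map_sum]
    simp only [haarCoeffL_apply]
    rw [Finset.sum_eq_single J (fun I _ hI => haarCoeff_haarL_of_ne hI _), haarCoeff_haarL_self]
    intro hJ
    rw [Finsupp.notMem_support_iff.1 hJ, map_zero, ← haarCoeffL_apply, map_zero]
  rw [haarTerm_eq, h, smul_smul, inv_mul_cancel₀ J.length_pos.ne', one_smul]

/-- The Haar projections onto finite sets are uniformly bounded. -/
theorem enorm_sum_haarTerm_le (hp1 : 1 < p) (hp : p ≠ ∞) (hβ : IsUMDBound p X β) (hβ1 : 1 ≤ β)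
    (F : Finset DyadicInterval) (u : Lp X p (volume : Measure ℝ)) :
    ‖∑ J ∈ F, haarTerm u J‖ₑ ≤ β * ‖u‖ₑ := by
  classical
  -- both sides are continuous in `u`, so `u` may be taken to be a finite Haar sum
  have hcont : Continuous fun u : Lp X p (volume : Measure ℝ) => ∑ J ∈ F, haarTerm u J := by
    refine continuous_finsetSum _ fun J _ => ?_
    simp only [haarTerm_eq, ← haarCoeffL_apply]
    fun_prop
  by_cases hβt : β = ∞
  · by_cases hu : u = 0
    · have : ∀ J, haarTerm u J = 0 := fun J => by
        rw [haarTerm_eq, hu, ← haarCoeffL_apply, map_zero, smul_zero, map_zero]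
      simp [this]
    · rw [hβt, ENNReal.top_mul (by simpa using hu)]
      exact le_top
  refine (denseRange_haarSum hp1 hp).induction_on u
    (isClosed_le (continuous_enorm.comp hcont)
      ((ENNReal.continuous_const_mul hβt).comp continuous_enorm)) fun f => ?_
  rw [sum_haarTerm_haarSum]
  have e : haarSum p X f = ∑ I ∈ F ∪ f.support, haarL p X I (f I) := by
    rw [haarSum_apply]
    refine Finset.sum_subset Finset.subset_union_right fun I _ hI => ?_
    rw [Finsupp.notMem_support_iff.1 hI, map_zero]
  rw [e]
  exact enorm_sum_haarL_le_of_subset hp hβ hβ1 Finset.subset_union_left f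

/-- Unconditional convergence of Haar series. -/
theorem summable_haarTerm (hp1 : 1 < p) (hp : p ≠ ∞) (hβ : IsUMDBound p X β) (hβ1 : 1 ≤ β)
    (hβt : β ≠ ∞) (u : Lp X p (volume : Measure ℝ)) : Summable fun I => haarTerm u I := by
  rw [summable_iff_vanishing_norm]
  intro ε hε
  have hpos : 0 < β.toReal := ENNReal.toReal_pos (zero_lt_one.trans_le hβ1).ne' hβt
  obtain ⟨f, hf⟩ := (denseRange_haarSum (X := X) hp1 hp).exists_dist_lt u
    (div_pos hε hpos)
  refine ⟨f.support, fun t ht => ?_⟩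
  have h0 : ∑ I ∈ t, haarTerm (haarSum p X f) I = 0 := by
    rw [sum_haarTerm_haarSum]
    refine Finset.sum_eq_zero fun I hI => ?_
    rw [Finsupp.notMem_support_iff.1 (Finset.disjoint_left.1 ht hI), map_zero]
  have e : ∑ I ∈ t, haarTerm u I = ∑ I ∈ t, haarTerm (u - haarSum p X f) I := by
    have : ∀ I, haarTerm (u - haarSum p X f) I = haarTerm u I - haarTerm (haarSum p X f) I := by
      intro I
      simp only [haarTerm_eq, ← haarCoeffL_apply, map_sub, smul_sub]
    simp only [this, Finset.sum_sub_distrib, h0, sub_zero]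
  have hb := ENNReal.toReal_mono (ENNReal.mul_ne_top hβt enorm_ne_top)
    (enorm_sum_haarTerm_le hp1 hp hβ hβ1 t (u - haarSum p X f))
  rw [toReal_enorm, ENNReal.toReal_mul, toReal_enorm, ← e] at hb
  rw [dist_eq_norm, lt_div_iff₀ hpos] at hf
  linarith

theorem IsShiftCompatible.enorm_sum_rearrangedL_le {m M α γ : ℕ} {𝓒 : Set DyadicInterval}
    (h : IsShiftCompatible m (M + 2) α γ 𝓒) (hm : 1 ≤ m)
    (hα : 2 * (α + 1) ≤ M + 2) (hγ : M + 2 ≤ 2 * γ) (hγ' : γ + 1 ≤ M + 2)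
    (hp : p ≠ ∞) (hβ : IsUMDBound p X β) (hβ1 : 1 ≤ β)
    (F : Finset DyadicInterval) (hF : ∀ I ∈ F, I ∈ 𝓒) (x : DyadicInterval → X) :
    ‖∑ I ∈ F, rearrangedL p X m I (x I)‖ₑ
      ≤ (3 * M + 4) * β ^ 4 * ‖∑ I ∈ F, haarL p X I (x I)‖ₑ := by
  simp only [haarL, rearrangedL]
  rw [enorm_sum_tensorL (fun I => (isBlock_haar I).toIsBddFun),
    enorm_sum_tensorL (fun I => isBddFun_rearrangedHaar m I)]
  exact h.sumNorm_rearrangedHaar_le hm hα hγ hγ' Fact.out hp hβ hβ1 F hF _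

/-- The estimate for finite Haar sums over one of the collections of the splitting. -/
theorem enorm_sum_rearrangedL_le {m i : ℕ} (hm : 1 ≤ m) {𝓑 : Set DyadicInterval}
    (h𝓑 : 𝓑 = splitColl₀ m i ∨ 𝓑 = splitColl₁₀ m i ∨ 𝓑 = splitColl₁₁ m i)
    (hp : p ≠ ∞) (hβ : IsUMDBound p X β) (hβ1 : 1 ≤ β)
    (F : Finset DyadicInterval) (hF : ∀ I ∈ F, I ∈ 𝓑) (x : DyadicInterval → X) :
    ‖∑ I ∈ F, rearrangedL p X m I (x I)‖ₑ ≤ 44 * β ^ 5 * ‖∑ I ∈ F, haarL p X I (x I)‖ₑ := by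
  classical
  have h1 : 𝓑 ⊆ splitColl₁ m i → ‖∑ I ∈ F, rearrangedL p X m I (x I)‖ₑ
      ≤ 44 * β ^ 5 * ‖∑ I ∈ F, haarL p X I (x I)‖ₑ := by
    intro hs
    obtain ⟨i', h1, h2⟩ := splitColl₁_subset (m := m) (i := i)
    refine ((isShiftCompatible_of_level₁ hm h1 h2).enorm_sum_rearrangedL_le hm (by norm_num)
      (by norm_num) (by norm_num) hp hβ hβ1 F (fun I hI => hs (hF I hI)) x).trans ?_
    have e : (3 * (10 : ℕ) + 4 : ℝ≥0∞) = 34 := by norm_num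
    rw [e]
    gcongr <;> norm_num
  rcases h𝓑 with h | h | h
  · obtain ⟨i', h1, h2⟩ := splitColl₀_subset (m := m) (i := i)
    set F₁ := F.filter fun I => IsCentral m I
    set F₂ := F.filter fun I => ¬ IsCentral m I
    have hc₁ : IsShiftCompatible m (6 + 2) 0 7 {I ∈ 𝓑 | IsCentral m I} :=
      isShiftCompatible_central hm (fun I hI => h1 (h ▸ hI.1))
        (h2.imp (fun h2 I hI => h2 (h ▸ hI.1)) fun h2 I hI => h2 (h ▸ hI.1)) fun I hI => hI.2
    have hc₂ : IsShiftCompatible m (6 + 2) 3 4 {I ∈ 𝓑 | ¬ IsCentral m I} :=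
      isShiftCompatible_not_central hm (fun I hI => h1 (h ▸ hI.1))
        (h2.imp (fun h2 I hI => h2 (h ▸ hI.1)) fun h2 I hI => h2 (h ▸ hI.1)) fun I hI => hI.2
    have k₁ := hc₁.enorm_sum_rearrangedL_le hm (by norm_num) (by norm_num) (by norm_num) hp hβ hβ1
      F₁ (fun I hI => ⟨hF I (Finset.mem_filter.1 hI).1, (Finset.mem_filter.1 hI).2⟩) x
    have k₂ := hc₂.enorm_sum_rearrangedL_le hm (by norm_num) (by norm_num) (by norm_num) hp hβ hβ1
      F₂ (fun I hI => ⟨hF I (Finset.mem_filter.1 hI).1, (Finset.mem_filter.1 hI).2⟩) x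
    have l₁ := enorm_sum_haarL_le_of_subset hp hβ hβ1 (Finset.filter_subset _ F : F₁ ⊆ F) x
    have l₂ := enorm_sum_haarL_le_of_subset hp hβ hβ1 (Finset.filter_subset _ F : F₂ ⊆ F) x
    have e : (3 * (6 : ℕ) + 4 : ℝ≥0∞) = 22 := by norm_num
    rw [e] at k₁ k₂
    set H := ‖∑ I ∈ F, haarL p X I (x I)‖ₑ
    calc ‖∑ I ∈ F, rearrangedL p X m I (x I)‖ₑ
        = ‖∑ I ∈ F₁, rearrangedL p X m I (x I) + ∑ I ∈ F₂, rearrangedL p X m I (x I)‖ₑ := by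
          rw [Finset.sum_filter_add_sum_filter_not]
      _ ≤ 22 * β ^ 4 * (β * H) + 22 * β ^ 4 * (β * H) :=
          (enorm_add_le _ _).trans (add_le_add (k₁.trans (by gcongr)) (k₂.trans (by gcongr)))
      _ = 44 * β ^ 5 * H := by ring
  · exact h1 (h ▸ fun I hI => hI.1)
  · exact h1 (h ▸ fun I hI => hI.1)

/-- Domination of the finite sums passes to the sums of the series. -/
theorem summable_and_norm_tsum_le_of_norm_sum_le {ι E : Type*} [NormedAddCommGroup E]
    [CompleteSpace E] {z w : ι → E} {C : ℝ} (hC : 0 ≤ C)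
    (h : ∀ F : Finset ι, ‖∑ i ∈ F, w i‖ ≤ C * ‖∑ i ∈ F, z i‖) (hz : Summable z) :
    Summable w ∧ ‖∑' i, w i‖ ≤ C * ‖∑' i, z i‖ := by
  have hw : Summable w := by
    rw [summable_iff_vanishing_norm] at hz ⊢
    intro ε hε
    obtain ⟨s, hs⟩ := hz (ε / (C + 1)) (by positivity)
    refine ⟨s, fun t ht => ?_⟩
    have h1 := hs t ht
    rw [lt_div_iff₀ (by positivity)] at h1
    nlinarith [h t, norm_nonneg (∑ i ∈ t, z i)]
  exact ⟨hw, le_of_tendsto_of_tendsto' hw.hasSum.norm (hz.hasSum.norm.const_mul C) h⟩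

/-- `P_𝓑 u` has the Haar coefficients of `u` on `𝓑` and no others. -/
theorem haarCoeff_haarProj (hp1 : 1 < p) (hp : p ≠ ∞) (hβ : IsUMDBound p X β) (hβ1 : 1 ≤ β)
    (hβt : β ≠ ∞) (𝓑 : Set DyadicInterval) (u : Lp X p (volume : Measure ℝ))
    (I : DyadicInterval) :
    haarCoeff (haarProj 𝓑 u) I = 𝓑.indicator (fun I => haarCoeff u I) I := by
  have hs := (summable_haarTerm hp1 hp hβ hβ1 hβt u).indicator 𝓑
  have hterm : ∀ J, haarCoeffL X I (𝓑.indicator (fun J => haarTerm u J) J)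
      = 𝓑.indicator (fun J => haarCoeff (haarTerm u J) I) J := by
    intro J
    by_cases hJ : J ∈ 𝓑
    · rw [indicator_of_mem hJ, indicator_of_mem hJ, haarCoeffL_apply]
    · rw [indicator_of_notMem hJ, indicator_of_notMem hJ, map_zero]
  rw [haarProj, tsum_subtype 𝓑 fun J => haarTerm u J, ← haarCoeffL_apply,
    ContinuousLinearMap.map_tsum _ hs]
  simp only [hterm]
  rw [tsum_eq_single I]
  · by_cases hI : I ∈ 𝓑
    · rw [indicator_of_mem hI, indicator_of_mem hI, haarTerm_eq, haarCoeff_haarL_self, smul_smul,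
        mul_inv_cancel₀ I.length_pos.ne', one_smul]
    · rw [indicator_of_notMem hI, indicator_of_notMem hI]
  · intro J hJ
    refine indicator_apply_eq_zero.2 fun _ => ?_
    rw [haarTerm_eq, haarCoeff_haarL_of_ne hJ]

theorem summable_and_norm_rearrangement_le {m i : ℕ} (hm : 1 ≤ m) {𝓑 : Set DyadicInterval}
    (h𝓑 : 𝓑 = splitColl₀ m i ∨ 𝓑 = splitColl₁₀ m i ∨ 𝓑 = splitColl₁₁ m i)
    (hp1 : 1 < p) (hp : p ≠ ∞) (hβ : IsUMDBound p X β) (hβ1 : 1 ≤ β) (hβt : β ≠ ∞)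
    (u : Lp X p (volume : Measure ℝ)) :
    Summable (fun I : 𝓑 => haarTerm u I) ∧
      Summable (fun I => rearrangedTerm m (haarProj 𝓑 u) I) ∧
      ‖rearrangement m (haarProj 𝓑 u)‖ ≤ 44 * β.toReal ^ 5 * ‖haarProj 𝓑 u‖ := by
  classical
  have hs := summable_haarTerm hp1 hp hβ hβ1 hβt u
  have hterm : ∀ I, rearrangedTerm m (haarProj 𝓑 u) I
      = 𝓑.indicator (fun I => rearrangedL p X m I (I.length⁻¹ • haarCoeff u I)) I := by
    intro I
    rw [rearrangedTerm_eq, haarCoeff_haarProj hp1 hp hβ hβ1 hβt]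
    by_cases hI : I ∈ 𝓑 <;> simp [hI]
  have hsum : ∀ (g : DyadicInterval → Lp X p (volume : Measure ℝ)) (F : Finset DyadicInterval),
      ∑ I ∈ F, 𝓑.indicator g I = ∑ I ∈ F with I ∈ 𝓑, g I := by
    intro g F
    rw [Finset.sum_filter]
    rfl
  refine ⟨hs.subtype 𝓑, ?_⟩
  have key := summable_and_norm_tsum_le_of_norm_sum_le (C := 44 * β.toReal ^ 5) (by positivity)
    (z := 𝓑.indicator fun I => haarTerm u I) (w := fun I => rearrangedTerm m (haarProj 𝓑 u) I)
    (fun F => ?_) (hs.indicator 𝓑)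
  · rw [haarProj, tsum_subtype 𝓑 fun J => haarTerm u J]
    simp only [haarProj, tsum_subtype 𝓑 fun J => haarTerm u J] at key
    exact key
  · simp only [hterm, hsum, haarTerm_eq]
    have h := enorm_sum_rearrangedL_le hm h𝓑 hp hβ hβ1 (F.filter fun I => I ∈ 𝓑)
      (fun I hI => (Finset.mem_filter.1 hI).2) fun I => I.length⁻¹ • haarCoeff u I
    have hC : (44 * β ^ 5 : ℝ≥0∞) ≠ ∞ :=
      ENNReal.mul_ne_top (by norm_num) (ENNReal.pow_ne_top hβt)
    have h' := ENNReal.toReal_mono (ENNReal.mul_ne_top hC enorm_ne_top) h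
    rwa [toReal_enorm, ENNReal.toReal_mul, toReal_enorm, ENNReal.toReal_mul,
      ENNReal.toReal_pow, ENNReal.toReal_ofNat] at h'

end Series

end FigielShift

theorem mainTheorem2 :
    (∀ m : ℕ, 1 ≤ m → (DyadicInterval.lastIndex m : ℝ) ≤ 7 + 2 * Real.logb 2 m) ∧
    ∃ C : ℝ≥0∞ → ℝ≥0,
      ∀ (p : ℝ≥0∞) [Fact (1 ≤ p)], 1 < p → p < ∞ →
      ∀ (X : Type*) [NormedAddCommGroup X] [NormedSpace ℝ X] [CompleteSpace X],
        umdConst p X < ∞ →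
      ∀ m : ℕ, 1 ≤ m → ∀ i : ℕ, i ≤ DyadicInterval.lastIndex m →
      ∀ 𝓑 : Set DyadicInterval,
        (𝓑 = DyadicInterval.splitColl₀ m i ∨ 𝓑 = DyadicInterval.splitColl₁₀ m i ∨
          𝓑 = DyadicInterval.splitColl₁₁ m i) →
      ∀ u : Lp X p (volume : Measure ℝ),
        Summable (fun I : 𝓑 => DyadicInterval.haarTerm u I) ∧
        Summable (fun I : DyadicInterval =>
          DyadicInterval.rearrangedTerm m (DyadicInterval.haarProj 𝓑 u) I) ∧
        ‖DyadicInterval.rearrangement m (DyadicInterval.haarProj 𝓑 u)‖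
          ≤ C (umdConst p X) * ‖DyadicInterval.haarProj 𝓑 u‖ := by
  refine ⟨fun m hm => FigielShift.lastIndex_le hm, fun U => 44 * (U + 1).toNNReal ^ 5, ?_⟩
  intro p _ hp1 hp X _ _ _ hU m hm i _ 𝓑 h𝓑 u
  exact FigielShift.summable_and_norm_rearrangement_le hm h𝓑 hp1 hp.ne
    (FigielShift.exists_umdBound hU) le_add_self (ENNReal.add_ne_top.2 ⟨hU.ne, ENNReal.one_ne_top⟩) u
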